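/- **Presentations.** A *symmetric triangular presentation* $\langle S\mid R\rangle$ consists of a finite set $S$ of formal generators with a distinguished element $e$, an involution $s\mapsto s^{-1}$ of $S$ with $e^{-1}=e$, and a finite set $R$ of words of length three in $S$ (not necessarily reduced) such that $eee\in R$; $ss^{-1}e\in R$ for all $s\neq e$; and $abc\in R$ implies $bca,\,cab,\,c^{-1}b^{-1}a^{-1}\in R$. The presented group is the group generated by $S$ with relators $R$, in which the symbol $e$ stands for the neutral element. **Sufficiently generic elements.** Let $G$ be a group and $F_T$ the free group on a set $T$. An element $x\in G\ast F_T$ is *sufficiently generic* if for every field $\mathbb L\supseteq\mathbb C$, every $n$ and every representation $\rho:G\ast F_T\to \mathrm{GL}_n(\mathbb L)$ such that (1) for each $g\in G$ the matrix $\rho(g)$ is $I_n$ or the permutation matrix of a derangement, and (2) the indexed family of all entries of the matrices $\rho(t)$, $t\in T$, is algebraically independent over $\mathbb C$, the matrix $\rho(x)-I_n$ is invertible or $0$. **Scramblings.** Let $G=\langle S\mid R\rangle$ be given by a symmetric triangular presentation and let $F_R$ be the free group on letters $f_r$, $r\in R$. A *scrambling* of $\langle S\mid R\rangle$ is a symmetric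 triangular presentation $G'=\langle S'\mid R'\rangle$ together with an $N\ge 0$ and an isomorphism $\mu:G'\to (G\ast F_R)\times\mathbb Z^N$, by which the two groups are identified, an injection $i:S\to S'$, a basis $b_1,\dots,b_N$ of $\mathbb Z^N$ and a map $j:\{b_1,\dots,b_N\}\to S'$, such that, with $\pi_G$ and $\pi_{\mathbb Z}$ the projections to $G$ and $\mathbb Z^N$, and $\pi^{\rm ab}_{F,\mathbb Z}$ the projection to $F_R\times\mathbb Z^N$ followed by the abelianization $F_R\to\mathbb Z^{R}$: * $\pi^{\rm ab}_{F,\mathbb Z}(x)\ne\pi^{\rm ab}_{F,\mathbb Z}(y)$ for distinct $x,y\in S'$; * for all $x,x',x''\in S'$, either $\pi^{\rm ab}_{F,\mathbb Z}(x''x'x)\neq0$, or $x''x'x=e$ in $G'$, or $x''x'x$ is a sufficiently generic element of $G\ast F_R$; * $\pi_G(i(s))=s$ in $G$ for all $s\in S$, and $\mu(j(b_m))=(e,b_m)$ for all $m$; * for each $s\in S$ we have $\mu(i(s))\in (G\ast\{e\})\times\mathbb Z^N$, and there is a $k$ such that the $b_k$-coefficient $c_k$ of $\pi_{\mathbb Z}(i(s))$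 satisfies $c_k\ge5$ and the $b_k$-coefficient of $\pi_{\mathbb Z}(x)$ has absolute value at most $c_k+1$ for every $x\in S'$. **Augmentation.** Given a scrambling and $s\in S$, put $s'=i(s)$ and write $-2\,\pi_{\mathbb Z}(s')=\varepsilon_1b_{k_1}+\dots+\varepsilon_rb_{k_r}$ with $\varepsilon_l\in\{-1,1\}$ and $r$ minimal. Put $\beta_l=j(b_{k_l})^{\varepsilon_l}\in S'$. The *augmentation* $G''=\langle S''\mid R''\rangle$ has as generators $S'$ together with the new symbols $z_1,\dots,z_4$; $u_{z_a,m}$ ($1\le a\le4$, $1\le m\le N$); $v_1,v_2,v_3$; $p_0,\dots,p_r$; $q_0,\dots,q_{r-1}$; $w_0,\dots,w_r$; $t$; and a formal inverse of each new symbol. The set $R''$ is the closure under cyclic shifts and formal inversion of words of $R'$ together with the relators $yy^{-1}e$ and $y^{-1}ye$ for every new symbol $y$ and $$j(b_m)z_au_{z_a,m}^{-1},\quad u_{z_a,m}j(b_m)^{-1}z_a^{-1}\qquad(1\le a\le 4,\ 1\le m\le N),$$ $$z_3s'v_1^{-1},\quad v_1z_1v_2^{-1},\quad v_2s'v_3^{-1},\quad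 z_3^{-1}v_3p_0^{-1},$$ $$p_lz_2q_l^{-1},\quad q_l\beta_{l+1}p_{l+1}^{-1}\quad(0\le l<r),$$ $$z_4p_rw_0^{-1},\quad w_lz_2^{-1}w_{l+1}^{-1}\quad(0\le l<r),\quad z_4^{-1}w_rt^{-1}.$$ **Statement.** Let $G=\langle S\mid R\rangle$ be given by a symmetric triangular presentation, let $G'=\langle S'\mid R'\rangle$ be a scrambling of it, let $s\in S$, and let $G''=\langle S''\mid R''\rangle$ be the augmentation at $s$ (for any choice of the minimal expression above). Then the following are equivalent. (i) There exist a field $\mathbb F\supseteq\mathbb C$, an integer $n\ge1$ and a representation $\rho:G\to\mathrm{GL}_n(\mathbb F)$ with $\rho(s)\ne\rho(e)$. (ii) There exist a field $\mathbb F\supseteq\mathbb C$, an integer $n\ge1$ and a representation $\tilde\rho:G''\to\mathrm{GL}_n(\mathbb F)$ such that (a) if $x,x'\in S''$ are distinct generators, then $\tilde\rho(x)-\tilde\rho(x')$ is invertible; (b) for all (not necessarily distinct) $x,x',x''\in S''$ the matrix $\tilde\rho(x'')^{-1}-\tilde\rho(x'x)$ is invertible or $0$. -/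

import Mathlib

universe u v

/-- A symmetric triangular presentation on a finite set `S` of formal generators.
`e` is the generator which stands for the neutral element, `inv` sends a generator to its formal
inverse, and `rel` is the set of relators, each of them a (not necessarily reduced) word `abc`
of length three, given as the triple `(a, b, c)`. -/
structure SymTriPres (S : Type u) where
  e : S
  inv : S → S
  rel : Set (S × S × S)
  finite_gen : Finite S
  inv_e : inv e = e
  inv_inv : ∀ s, inv (inv s) = s
  inv_mem : ∀ s, s ≠ e → (s, inv s, e) ∈ rel
  cyc_mem : ∀ a b c, (a, b, c) ∈ rel → (b, c, a) ∈ rel ∧ (c, a, b) ∈ rel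
  rev_mem : ∀ a b c, (a, b, c) ∈ rel → (inv c, inv b, inv a) ∈ rel
  eee_mem : (e, e, e) ∈ rel

namespace SymTriPres

variable {S : Type u}

/-- The relators as elements of the free group on `S`. The word `e` is included because the
generator `e` stands for the neutral element. -/
def relWords (P : SymTriPres S) : Set (FreeGroup S) :=
  {w | w = FreeGroup.of P.e ∨ ∃ a b c, (a, b, c) ∈ P.rel ∧
    w = FreeGroup.of a * FreeGroup.of b * FreeGroup.of c}

/-- The group `⟨S ∣ R⟩`. -/
abbrev Grp (P : SymTriPres S) : Type u := PresentedGroup P.relWords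

/-- The element of `⟨S ∣ R⟩` given by a generator. -/
def gen (P : SymTriPres S) (s : S) : P.Grp := PresentedGroup.of s

end SymTriPres

/-- `x ∈ G ∗ F_T` is sufficiently generic: for every field `L ⊇ ℂ`, every `n` and every
representation `ρ : G ∗ F_T → GL_n(L)` such that each `ρ(g)`, `g ∈ G`, is the identity matrix or
the permutation matrix of a derangement, and such that the entries of all the matrices `ρ(t)`,
`t ∈ T`, form an algebraically independent family over `ℂ`, the matrix `ρ(x) - 1` is invertible
or zero. -/
def SufficientlyGeneric {G : Type u} [Group G] {T : Type v}
    (x : Monoid.Coprod G (FreeGroup T)) : Prop :=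
  ∀ (L : Type) [Field L] [Algebra ℂ L] (n : ℕ)
    (ρ : Monoid.Coprod G (FreeGroup T) →* Matrix.GeneralLinearGroup (Fin n) L),
    (∀ g : G, ρ (Monoid.Coprod.inl g) = 1 ∨
      ∃ σ : Equiv.Perm (Fin n), (∀ a, σ a ≠ a) ∧
        (ρ (Monoid.Coprod.inl g) : Matrix (Fin n) (Fin n) L) = σ.permMatrix L) →
    AlgebraicIndependent ℂ (fun p : T × Fin n × Fin n =>
      (ρ (Monoid.Coprod.inr (FreeGroup.of p.1)) : Matrix (Fin n) (Fin n) L) p.2.1 p.2.2) →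
    IsUnit ((ρ x : Matrix (Fin n) (Fin n) L) - 1) ∨ (ρ x : Matrix (Fin n) (Fin n) L) - 1 = 0

/-- The group `(G ∗ F_R) × ℤ^N`, where `G = ⟨S ∣ R⟩` and `F_R` is free on letters indexed
by `R`. -/
abbrev ScrTarget {S : Type u} (P : SymTriPres S) (N : ℕ) : Type u :=
  Monoid.Coprod P.Grp (FreeGroup P.rel) × Multiplicative (Fin N → ℤ)

namespace ScrTarget

variable {S : Type u} {P : SymTriPres S} {N : ℕ}

/-- The projection to `G`. -/
def piG : ScrTarget P N →* P.Grp := Monoid.Coprod.fst.comp (MonoidHom.fst _ _)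

/-- The projection to `ℤ^N`. -/
def piZ (x : ScrTarget P N) : Fin N → ℤ := x.2.toAdd

/-- The abelianization `F_R → ℤ^R`, sending the letter `f_r` to the `r`-th unit vector. -/
noncomputable def freeAb (P : SymTriPres S) : FreeGroup P.rel →* Multiplicative (P.rel →₀ ℤ) :=
  FreeGroup.lift fun r => Multiplicative.ofAdd (Finsupp.single r 1)

/-- The projection to `F_R × ℤ^N` followed by the abelianization of `F_R`. -/
noncomputable def piAb :
    ScrTarget P N →* Multiplicative (P.rel →₀ ℤ) × Multiplicative (Fin N → ℤ) :=
  MonoidHom.prodMap ((freeAb P).comp Monoid.Coprod.snd) (MonoidHom.id _)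

end ScrTarget

/-- The presentation `Q = ⟨S' ∣ R'⟩` on `T = S'` is a scrambling of `P = ⟨S ∣ R⟩`, with all the
data that the notion involves: `N`, the isomorphism `μ`, the maps `i` and `j`, and the basis `b`
of `ℤ^N`. -/
structure Scrambling {S : Type u} {T : Type v} (P : SymTriPres S) (Q : SymTriPres T) where
  N : ℕ
  μ : Q.Grp ≃* ScrTarget P N
  /-- distinct generators have distinct images in `ℤ^R × ℤ^N` -/
  piAb_injective : ∀ x y : T, x ≠ y →
    ScrTarget.piAb (μ (Q.gen x)) ≠ ScrTarget.piAb (μ (Q.gen y))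
  /-- products of three generators -/
  triple : ∀ x y z : T,
    ScrTarget.piAb (μ (Q.gen z * Q.gen y * Q.gen x)) ≠ 1 ∨
    Q.gen z * Q.gen y * Q.gen x = 1 ∨
    SufficientlyGeneric (μ (Q.gen z * Q.gen y * Q.gen x)).1
  i : S ↪ T
  piG_i : ∀ s, ScrTarget.piG (μ (Q.gen (i s))) = P.gen s
  b : Module.Basis (Fin N) ℤ (Fin N → ℤ)
  j : Fin N → T
  μ_j : ∀ k, μ (Q.gen (j k)) = (1, Multiplicative.ofAdd (b k))
  /-- `μ (i s)` lies in `(G ∗ 1) × ℤ^N` -/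
  μ_i : ∀ s, ∃ g : P.Grp, (μ (Q.gen (i s))).1 = Monoid.Coprod.inl g
  /-- some coefficient of the `ℤ^N`-part of `i s` is large -/
  large_coeff : ∀ s, ∃ k : Fin N,
    5 ≤ b.repr (ScrTarget.piZ (μ (Q.gen (i s)))) k ∧
    ∀ x : T, |b.repr (ScrTarget.piZ (μ (Q.gen x))) k| ≤
      b.repr (ScrTarget.piZ (μ (Q.gen (i s)))) k + 1

namespace Scrambling

variable {S : Type u} {T : Type v} {P : SymTriPres S} {Q : SymTriPres T}

/-- `ε₁ b_{k₁} + … + ε_r b_{k_r}`, with signs `ε_l ∈ {-1, 1}`, equals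
`-2 • π_ℤ (i s)`. -/
def IsExpression (D : Scrambling P Q) (s : S) {r : ℕ} (k : Fin r → Fin D.N) (ε : Fin r → ℤˣ) :
    Prop :=
  ∑ l, (ε l : ℤ) • D.b (k l) = (-2 : ℤ) • ScrTarget.piZ (D.μ (Q.gen (D.i s)))

/-- A minimal-length expression of `-2 • π_ℤ (i s)` as a signed sum of basis elements. -/
def IsMinExpression (D : Scrambling P Q) (s : S) {r : ℕ} (k : Fin r → Fin D.N)
    (ε : Fin r → ℤˣ) : Prop :=
  D.IsExpression s k ε ∧
    ∀ (r' : ℕ) (k' : Fin r' → Fin D.N) (ε' : Fin r' → ℤˣ), D.IsExpression s k' ε' → r ≤ r'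

/-- The generator `j(b_k)^ε` of the scrambling, for a sign `ε`. -/
def bPow (D : Scrambling P Q) (k : Fin D.N) (ε : ℤˣ) : T :=
  if ε = 1 then D.j k else Q.inv (D.j k)

end Scrambling

/-- The new symbols of the augmentation (without their formal inverses). `z k` for `k = 0,…,3` are
the letters `z₁,…,z₄`, and `u k i` is `u_{z_{k+1}, i}`. With `s'` the image of `s` and
`β_l = b_{k_l}^{ε_l}`, the remaining symbols are
`v1, v2, v3`, for the words `z₃ s'`, `z₃ s' z₁`, `z₃ s' z₁ s'`,
`p l` (`0 ≤ l ≤ r`), for the word `s' z₁ s' z₂ β₁ ⋯ z₂ β_l`,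
`q l` (`0 ≤ l < r`), for the word `s' z₁ s' z₂ β₁ ⋯ z₂ β_l z₂`,
`w l` (`0 ≤ l ≤ r`), for the word `z₄ s' z₁ s' z₂ β₁ ⋯ z₂ β_r z₂^{-l}`,
and `t`. -/
inductive AugSym (N r : ℕ) : Type
  | z (k : Fin 4)
  | u (k : Fin 4) (i : Fin N)
  | v1
  | v2
  | v3
  | p (l : Fin (r + 1))
  | q (l : Fin r)
  | w (l : Fin (r + 1))
  | t

/-- The generators `S''` of the augmentation: the old generators, the new symbols, and formal
inverses of the new symbols. -/
inductive AugGen (T : Type v) (N r : ℕ) : Type v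
  | old (x : T)
  | pos (y : AugSym N r)
  | neg (y : AugSym N r)

namespace AugGen

variable {T : Type v} {N r : ℕ}

/-- The formal inverse of a generator, extending that of the old generators. -/
def inv (f : T → T) : AugGen T N r → AugGen T N r
  | old x => old (f x)
  | pos y => neg y
  | neg y => pos y

end AugGen

theorem finite_augSym (N r : ℕ) : Finite (AugSym N r) := by
  let f : (Fin 4 ⊕ Fin 4 × Fin N) ⊕ (Fin 4 ⊕ (Fin (r + 1) ⊕ Fin r ⊕ Fin (r + 1))) → AugSym N r :=
    fun
    | .inl (.inl k) => .z k
    | .inl (.inr (k, i)) => .u k i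
    | .inr (.inl 0) => .v1
    | .inr (.inl 1) => .v2
    | .inr (.inl 2) => .v3
    | .inr (.inl 3) => .t
    | .inr (.inr (.inl l)) => .p l
    | .inr (.inr (.inr (.inl l))) => .q l
    | .inr (.inr (.inr (.inr l))) => .w l
  refine Finite.of_surjective f fun y => ?_
  cases y with
  | z k => exact ⟨.inl (.inl k), rfl⟩
  | u k i => exact ⟨.inl (.inr (k, i)), rfl⟩
  | v1 => exact ⟨.inr (.inl 0), rfl⟩
  | v2 => exact ⟨.inr (.inl 1), rfl⟩
  | v3 => exact ⟨.inr (.inl 2), rfl⟩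
  | t => exact ⟨.inr (.inl 3), rfl⟩
  | p l => exact ⟨.inr (.inr (.inl l)), rfl⟩
  | q l => exact ⟨.inr (.inr (.inr (.inl l))), rfl⟩
  | w l => exact ⟨.inr (.inr (.inr (.inr l))), rfl⟩

theorem finite_augGen (T : Type v) [Finite T] (N r : ℕ) : Finite (AugGen T N r) := by
  have := finite_augSym N r
  let f : T ⊕ AugSym N r ⊕ AugSym N r → AugGen T N r :=
    fun
    | .inl x => .old x
    | .inr (.inl y) => .pos y
    | .inr (.inr y) => .neg y
  refine Finite.of_surjective f fun g => ?_
  cases g with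
  | old x => exact ⟨.inl x, rfl⟩
  | pos y => exact ⟨.inr (.inl y), rfl⟩
  | neg y => exact ⟨.inr (.inr y), rfl⟩

namespace Scrambling

open AugGen AugSym

variable {S : Type u} {T : Type v} {P : SymTriPres S} {Q : SymTriPres T}

/-- The relators of the augmentation at `s`, before symmetrization: `AugRel D s k ε x y z`
says that `xyz` is one of them. -/
inductive AugRel (D : Scrambling P Q) (s : S) {r : ℕ} (k : Fin r → Fin D.N) (ε : Fin r → ℤˣ) :
    AugGen T D.N r → AugGen T D.N r → AugGen T D.N r → Prop
  /-- the relators of the scrambling -/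
  | old_rel {x y z : T} (h : (x, y, z) ∈ Q.rel) : AugRel D s k ε (old x) (old y) (old z)
  /-- the new symbols and their formal inverses are mutually inverse -/
  | pos_neg (y : AugSym D.N r) : AugRel D s k ε (pos y) (neg y) (old Q.e)
  | neg_pos (y : AugSym D.N r) : AugRel D s k ε (neg y) (pos y) (old Q.e)
  /-- `u = j(b_m) z` and `u j(b_m)⁻¹ z⁻¹ = e` -/
  | u_def (a : Fin 4) (m : Fin D.N) :
      AugRel D s k ε (old (D.j m)) (pos (z a)) (neg (u a m))
  | u_comm (a : Fin 4) (m : Fin D.N) :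
      AugRel D s k ε (pos (u a m)) (old (Q.inv (D.j m))) (neg (z a))
  /-- `v1 = z₃ s'`, `v2 = v1 z₁`, `v3 = v2 s'`, `p 0 = z₃⁻¹ v3` -/
  | v1_def : AugRel D s k ε (pos (z 2)) (old (D.i s)) (neg v1)
  | v2_def : AugRel D s k ε (pos v1) (pos (z 0)) (neg v2)
  | v3_def : AugRel D s k ε (pos v2) (old (D.i s)) (neg v3)
  | p_zero : AugRel D s k ε (neg (z 2)) (pos v3) (neg (p 0))
  /-- `q l = (p l) z₂` and `p (l + 1) = (q l) b_{k_{l+1}}^{ε_{l+1}}` -/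
  | q_def (l : Fin r) : AugRel D s k ε (pos (p l.castSucc)) (pos (z 1)) (neg (q l))
  | p_succ (l : Fin r) :
      AugRel D s k ε (pos (q l)) (old (D.bPow (k l) (ε l))) (neg (p l.succ))
  /-- `w 0 = z₄ (p r)` and `w (l + 1) = (w l) z₂⁻¹` -/
  | w_zero : AugRel D s k ε (pos (z 3)) (pos (p (Fin.last r))) (neg (w 0))
  | w_succ (l : Fin r) : AugRel D s k ε (pos (w l.castSucc)) (neg (z 1)) (neg (w l.succ))
  /-- `t = z₄⁻¹ (w r)` -/
  | t_def : AugRel D s k ε (neg (z 3)) (pos (w (Fin.last r))) (neg t)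

/-- Symmetrization: the closure of `AugRel` under cyclic shifts and inversion of words. -/
inductive AugRelSym (D : Scrambling P Q) (s : S) {r : ℕ} (k : Fin r → Fin D.N)
    (ε : Fin r → ℤˣ) : AugGen T D.N r → AugGen T D.N r → AugGen T D.N r → Prop
  | base {a b c} (h : AugRel D s k ε a b c) : AugRelSym D s k ε a b c
  | cyc {a b c} (h : AugRelSym D s k ε a b c) : AugRelSym D s k ε b c a
  | rev {a b c} (h : AugRelSym D s k ε a b c) :
      AugRelSym D s k ε (c.inv Q.inv) (b.inv Q.inv) (a.inv Q.inv)

/-- The augmentation `⟨S'' ∣ R''⟩` at `s` of a scrambling, built with the expression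
`ε₁ b_{k₁} + … + ε_r b_{k_r}`. -/
def augmentation (D : Scrambling P Q) (s : S) {r : ℕ} (k : Fin r → Fin D.N) (ε : Fin r → ℤˣ) :
    SymTriPres (AugGen T D.N r) where
  e := old Q.e
  inv := AugGen.inv Q.inv
  rel := {x | AugRelSym D s k ε x.1 x.2.1 x.2.2}
  finite_gen := by
    have := Q.finite_gen
    exact finite_augGen T D.N r
  inv_e := by simp [AugGen.inv, Q.inv_e]
  inv_inv := by
    intro x
    cases x <;> simp [AugGen.inv, Q.inv_inv]
  inv_mem := by
    intro x hx
    refine AugRelSym.base ?_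
    cases x with
    | old x => exact AugRel.old_rel (Q.inv_mem x fun h => hx (by rw [h]))
    | pos y => exact AugRel.pos_neg y
    | neg y => exact AugRel.neg_pos y
  cyc_mem := fun _ _ _ h => ⟨AugRelSym.cyc h, AugRelSym.cyc (AugRelSym.cyc h)⟩
  rev_mem := fun _ _ _ h => AugRelSym.rev h
  eee_mem := AugRelSym.base (AugRel.old_rel Q.eee_mem)

end Scrambling

/-! ### Finite quotients of finitely generated linear groups -/

/-! In `G''` the relators force t = s z₁ s (`gen_t`): the u-relators make the z_a commute with ℤ^N
(`commute_cenIncl_z`), and the β_l cancel the central part 2π_ℤ(s') of s' z₁ s'. If s acts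
trivially, then t and z₁ have the same image and (a) fails; this gives (ii) ⇒ (i).

Conversely, G is finitely generated, so by Malcev's argument (`exists_finite_quotient_of_linear`) s
survives in a finite quotient H. `augHom` maps `G''` to (G ∗ F_R ∗ F_4) × ℤ^N. Let G act there
through the regular representation of H, the free letters by matrices of independent indeterminates
and ℤ^N by indeterminate scalars. At such a generic point ρ(w) - 1 is invertible as soon as it is
invertible at one specialization (`RepPoint.exists_generic`). Scalar matrices for the letters settle
every w that is nontrivial in the abelianization of the free and central parts. For the other words
the source of invertibility is `exists_twist_matrix`: if p is the matrix of s, there are A and B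
such that p A p⁻¹ A⁻¹ and p B p B⁻¹ are scalars different from 1. Hence the commutator of s with
z_a, and s z_a s z_a⁻¹, generically have no eigenvalue 1.

The rest is combinatorics of products of two or three generators. Old generators are governed by the
axioms of a scrambling, and unbalanced products by the exponents of the z_a. The balanced ones are
trivial, have nonzero central part, or reduce to old generators and the two basic words by
conjugation and substitution (`IsGenericRep.unitOrOne_word`, `pairUnitOrOne`). The coefficient at
least 5 in s' excludes the coincidences that would leave, for instance, a bare conjugate of s, whose
permutation matrix has eigenvalue 1. -/

instance Int.isJacobsonRing : IsJacobsonRing ℤ := by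
  rw [isJacobsonRing_iff_prime_eq]
  intro I hI
  by_cases h : I = ⊥
  · subst h
    refine le_antisymm (fun x hx => ?_) Ideal.le_jacobson
    -- Here x² + 1 is a unit of ℤ, which forces x = 0.
    have hu := Ideal.mem_jacobson_bot.1 hx x
    rcases Int.isUnit_iff.1 hu with h | h
    · have : x * x = 0 := by linarith
      simpa using this
    · nlinarith [mul_self_nonneg x]
  · have := hI.isMaximal h
    exact Ideal.jacobson_eq_self_of_isMaximal

/-- A field which is a finitely generated ring is finite. -/
theorem IsField.finite_of_finiteType_int {K : Type*} [CommRing K] [alg : Algebra ℤ K] [Algebra.FiniteType ℤ K]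
    (h : IsField K) : Finite K := by
  obtain rfl : alg = Ring.toIntAlgebra K := Subsingleton.elim _ _
  let _ : Field K := h.toField
  -- Zariski's lemma over the Jacobson ring ℤ. Then the kernel of ℤ → K is maximal, hence nonzero,
  -- and K is a finitely generated torsion group.
  have hK : Module.Finite ℤ K := finite_of_finite_type_of_isJacobsonRing ℤ K
  have hint : (algebraMap ℤ K).IsIntegral := algebraMap_isIntegral_iff.2 inferInstance
  have hmax : (RingHom.ker (algebraMap ℤ K)).IsMaximal := by
    have := Ideal.isMaximal_comap_of_isIntegral_of_isMaximal (R := ℤ) (S := K) (⊥ : Ideal K)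
    exact this
  have hne : RingHom.ker (algebraMap ℤ K) ≠ ⊥ := by
    intro h
    rw [h] at hmax
    exact Int.not_isField (Ring.isField_iff_maximal_bot.2 hmax)
  obtain ⟨m, hm, hm0⟩ := Submodule.exists_mem_ne_zero_of_ne_bot hne
  have hfg : AddGroup.FG K := Module.Finite.iff_addGroup_fg.1 hK
  have hm' : (m : K) = 0 := by simpa using hm
  refine AddCommGroup.finite_of_fg_isAddTorsion K ?_
  refine fun x => ?_
  refine isOfFinAddOrder_iff_zsmul_eq_zero.2 ⟨m, hm0, ?_⟩
  simp [hm']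

/-- An element of a finitely generated group which acts nontrivially in a finite-dimensional
representation over a field acts nontrivially in a finite quotient. -/
theorem exists_finite_quotient_of_linear {G : Type u} [Group G] {S : Type v} [Finite S]
    (γ : S → G) (hγ : Subgroup.closure (Set.range γ) = ⊤) {F : Type} [Field F] {n : ℕ}
    (ρ : G →* Matrix.GeneralLinearGroup (Fin n) F) {g : G} (hg : ρ g ≠ 1) :
    ∃ (H : Type) (_ : Group H) (_ : Finite H) (q : G →* H), q g ≠ 1 := by
  obtain ⟨a, b, hab⟩ : ∃ a b, ((ρ g : Matrix (Fin n) (Fin n) F) - 1) a b ≠ 0 := by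
    by_contra! h
    refine hg (Units.ext (sub_eq_zero.1 ?_))
    ext a b
    exact h a b
  set c := ((ρ g : Matrix (Fin n) (Fin n) F) - 1) a b with hc
  -- Adjoining the inverse of a nonzero entry of ρ(g) - 1 makes that entry a unit, so it survives
  -- modulo every maximal ideal. The inverses of the generator matrices are adjoined so that ρ takes
  -- values in GL_n(A).
  let s : Set F := Set.range (fun p : S × Fin n × Fin n =>
      (ρ (γ p.1) : Matrix (Fin n) (Fin n) F) p.2.1 p.2.2) ∪
    Set.range (fun p : S × Fin n × Fin n =>
      ((ρ (γ p.1))⁻¹ : Matrix.GeneralLinearGroup (Fin n) F).val p.2.1 p.2.2) ∪ {c⁻¹}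
  have hs : s.Finite := ((Set.finite_range _).union (Set.finite_range _)).union
    (Set.finite_singleton _)
  let A := Algebra.adjoin ℤ s
  have hA : Algebra.FiniteType ℤ A := Algebra.FiniteType.adjoin_of_finite hs
  let ι : A →+* F := A.val.toRingHom
  have hι : Function.Injective ι := Subtype.val_injective
  have hιM : Function.Injective (Matrix.GeneralLinearGroup.map (n := Fin n) ι) :=
    Units.map_injective (Matrix.map_injective hι)
  have hrange : ∀ x, ρ x ∈ (Matrix.GeneralLinearGroup.map (n := Fin n) ι).range := by
    intro x
    have hx : x ∈ Subgroup.closure (Set.range γ) := hγ ▸ Subgroup.mem_top x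
    have hle : Subgroup.closure (Set.range γ) ≤
        (Matrix.GeneralLinearGroup.map (n := Fin n) ι).range.comap ρ := by
      rw [Subgroup.closure_le]
      rintro _ ⟨y, rfl⟩
      have h1 : ∀ i j, (ρ (γ y) : Matrix (Fin n) (Fin n) F) i j ∈ A := fun i j =>
        Algebra.subset_adjoin (Or.inl (Or.inl ⟨(y, i, j), rfl⟩))
      have h2 : ∀ i j, ((ρ (γ y))⁻¹ : Matrix.GeneralLinearGroup (Fin n) F).val i j ∈ A :=
        fun i j => Algebra.subset_adjoin (Or.inl (Or.inr ⟨(y, i, j), rfl⟩))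
      let M : Matrix (Fin n) (Fin n) A := fun i j => ⟨_, h1 i j⟩
      let M' : Matrix (Fin n) (Fin n) A := fun i j => ⟨_, h2 i j⟩
      have hM : ι.mapMatrix M = ρ (γ y) := rfl
      have hM' : ι.mapMatrix M' = ((ρ (γ y))⁻¹ : Matrix.GeneralLinearGroup (Fin n) F).val := rfl
      refine ⟨⟨M, M', ?_, ?_⟩, Units.ext rfl⟩
      · apply Matrix.map_injective hι
        change ι.mapMatrix _ = ι.mapMatrix _
        rw [map_mul, hM, hM', ← Units.val_mul, mul_inv_cancel, map_one, Units.val_one]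
      · apply Matrix.map_injective hι
        change ι.mapMatrix _ = ι.mapMatrix _
        rw [map_mul, hM, hM', ← Units.val_mul, inv_mul_cancel, map_one, Units.val_one]
    exact hle hx
  let ρA : G →* Matrix.GeneralLinearGroup (Fin n) A :=
    (MonoidHom.ofInjective hιM).symm.toMonoidHom.comp (ρ.codRestrict _ hrange)
  have hρA : ∀ x, Matrix.GeneralLinearGroup.map ι (ρA x) = ρ x := fun x =>
    MonoidHom.apply_ofInjective_symm hιM ⟨ρ x, hrange x⟩
  obtain ⟨m, hm⟩ := Ideal.exists_maximal A
  have : Algebra.FiniteType ℤ (A ⧸ m) := hA.of_surjective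
    (RingHom.toIntAlgHom (Ideal.Quotient.mk m)) Ideal.Quotient.mk_surjective
  have : Finite (A ⧸ m) := IsField.finite_of_finiteType_int
    ((Ideal.Quotient.maximal_ideal_iff_isField_quotient m).1 hm)
  have : Nontrivial (A ⧸ m) := Ideal.Quotient.nontrivial_iff.2 hm.ne_top
  refine ⟨Matrix.GeneralLinearGroup (Fin n) (A ⧸ m), inferInstance, inferInstance,
    (Matrix.GeneralLinearGroup.map (Ideal.Quotient.mk m)).comp ρA, fun h => ?_⟩
  let d : A := ((ρA g : Matrix (Fin n) (Fin n) A) - 1) a b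
  have hd : ι d = c := by
    have h1 : (ρ g : Matrix (Fin n) (Fin n) F) = ι.mapMatrix (ρA g).val := by
      rw [← hρA]; rfl
    rw [hc, h1, ← map_one ι.mapMatrix, ← map_sub]
    rfl
  have hd0 : Ideal.Quotient.mk m d = 0 := by
    have h1 : (Ideal.Quotient.mk m).mapMatrix (ρA g).val = 1 := congrArg Units.val h
    have h2 : (Ideal.Quotient.mk m).mapMatrix ((ρA g : Matrix (Fin n) (Fin n) A) - 1) = 0 := by
      rw [map_sub, h1, map_one, sub_self]
    exact congrFun (congrFun h2 a) b
  have hcA : c⁻¹ ∈ A := Algebra.subset_adjoin (Or.inr rfl)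
  have hd1 : d * ⟨c⁻¹, hcA⟩ = 1 := by
    apply hι
    rw [map_mul, hd, map_one]
    exact mul_inv_cancel₀ hab
  have := congrArg (Ideal.Quotient.mk m) hd1
  rw [map_mul, hd0, zero_mul, map_one] at this
  exact zero_ne_one this

/-! ### Representations of `(G ∗ F_T ∗ F_4) × ℤ^N` -/

/-- The group `(G ∗ F_T ∗ F_4) × ℤ^N`. -/
abbrev AugTarget (G : Type u) [Group G] (T : Type v) (N : ℕ) : Type (max u v) :=
  Monoid.Coprod (Monoid.Coprod G (FreeGroup T)) (FreeGroup (Fin 4)) × Multiplicative (Fin N → ℤ)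

/-- Permutation matrices as a homomorphism to the general linear group. -/
def permGL (R : Type*) [CommRing R] (n : ℕ) :
    Equiv.Perm (Fin n) →* Matrix.GeneralLinearGroup (Fin n) R :=
  Matrix.permMatrixHom.toHomUnits

/-- The inverse appears because `permMatrix` reverses products. -/
theorem permGL_val (R : Type*) [CommRing R] {n : ℕ} (σ : Equiv.Perm (Fin n)) :
    (permGL R n σ).val = σ⁻¹.permMatrix R := rfl

theorem map_permGL {R R' : Type*} [CommRing R] [CommRing R'] (f : R →+* R') {n : ℕ}
    (σ : Equiv.Perm (Fin n)) :
    Matrix.GeneralLinearGroup.map f (permGL R n σ) = permGL R' n σ := by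
  refine Units.ext ?_
  change (σ⁻¹.permMatrix R).map f = σ⁻¹.permMatrix R'
  ext i j
  simp [PEquiv.toMatrix_apply]

/-- The homomorphism `ℤ^N → A` with prescribed values at the standard basis. -/
def zpowProd {A : Type*} [CommGroup A] {N : ℕ} (y : Fin N → A) :
    Multiplicative (Fin N → ℤ) →* A where
  toFun x := ∏ m, y m ^ x.toAdd m
  map_one' := by simp
  map_mul' a b := by simp [zpow_add, Finset.prod_mul_distrib]

/-- The matrices and scalars that determine a representation of `(G ∗ F_T ∗ F_4) × ℤ^N`, once
the restriction to `G` is given. -/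
@[ext]
structure RepPoint (R : Type*) [CommRing R] (n : ℕ) (T : Type v) (N : ℕ) where
  X : T → Matrix.GeneralLinearGroup (Fin n) R
  Z : Fin 4 → Matrix.GeneralLinearGroup (Fin n) R
  y : Fin N → Rˣ

namespace RepPoint

variable {R R' : Type*} [CommRing R] [CommRing R'] {n N : ℕ} {G : Type u} [Group G] {T : Type v}

/-- Base change. -/
def map (f : R →+* R') (d : RepPoint R n T N) : RepPoint R' n T N where
  X t := Matrix.GeneralLinearGroup.map f (d.X t)
  Z a := Matrix.GeneralLinearGroup.map f (d.Z a)
  y m := Units.map f (d.y m)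

/-- The representation of `G ∗ F_T ∗ F_4`. -/
def wordRep (π : G →* Equiv.Perm (Fin n)) (d : RepPoint R n T N) :
    Monoid.Coprod (Monoid.Coprod G (FreeGroup T)) (FreeGroup (Fin 4)) →*
      Matrix.GeneralLinearGroup (Fin n) R :=
  Monoid.Coprod.lift (Monoid.Coprod.lift ((permGL R n).comp π) (FreeGroup.lift d.X))
    (FreeGroup.lift d.Z)

/-- The representation of `(G ∗ F_T ∗ F_4) × ℤ^N`. -/
def rep (π : G →* Equiv.Perm (Fin n)) (d : RepPoint R n T N) :
    AugTarget G T N →* Matrix.GeneralLinearGroup (Fin n) R :=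
  MonoidHom.noncommCoprod (d.wordRep π)
    ((Matrix.GeneralLinearGroup.scalar (Fin n)).comp (zpowProd d.y))
    fun _ _ => (Matrix.GeneralLinearGroup.scalar_commute _ _).symm

theorem rep_mk (π : G →* Equiv.Perm (Fin n)) (d : RepPoint R n T N) (w c) :
    d.rep π (w, c) = d.wordRep π w * Matrix.GeneralLinearGroup.scalar (Fin n) (zpowProd d.y c) :=
  rfl

@[simp]
theorem wordRep_inl_inl (π : G →* Equiv.Perm (Fin n)) (d : RepPoint R n T N) (g : G) :
    d.wordRep π (Monoid.Coprod.inl (Monoid.Coprod.inl g)) = permGL R n (π g) := by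
  simp [wordRep]

@[simp]
theorem wordRep_inl_inr (π : G →* Equiv.Perm (Fin n)) (d : RepPoint R n T N) (t : T) :
    d.wordRep π (Monoid.Coprod.inl (Monoid.Coprod.inr (FreeGroup.of t))) = d.X t := by
  simp [wordRep]

@[simp]
theorem wordRep_inr (π : G →* Equiv.Perm (Fin n)) (d : RepPoint R n T N) (a : Fin 4) :
    d.wordRep π (Monoid.Coprod.inr (FreeGroup.of a)) = d.Z a := by
  simp [wordRep]

theorem wordRep_hom_ext {K : Type*} [Monoid K]
    {f g : Monoid.Coprod (Monoid.Coprod G (FreeGroup T)) (FreeGroup (Fin 4)) →* K}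
    (h₁ : ∀ x, f (Monoid.Coprod.inl (Monoid.Coprod.inl x)) =
      g (Monoid.Coprod.inl (Monoid.Coprod.inl x)))
    (h₂ : ∀ t, f (Monoid.Coprod.inl (Monoid.Coprod.inr (FreeGroup.of t))) =
      g (Monoid.Coprod.inl (Monoid.Coprod.inr (FreeGroup.of t))))
    (h₃ : ∀ a, f (Monoid.Coprod.inr (FreeGroup.of a)) =
      g (Monoid.Coprod.inr (FreeGroup.of a))) : f = g := by
  refine Monoid.Coprod.hom_ext (Monoid.Coprod.hom_ext ?_ ?_) ?_
  · ext x; exact h₁ x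
  · ext t; exact h₂ t
  · ext a; exact h₃ a

theorem wordRep_map (π : G →* Equiv.Perm (Fin n)) (f : R →+* R') (d : RepPoint R n T N) :
    (d.map f).wordRep π = (Matrix.GeneralLinearGroup.map f).comp (d.wordRep π) := by
  refine wordRep_hom_ext (fun x => ?_) (fun t => ?_) (fun a => ?_)
  · rw [MonoidHom.comp_apply, wordRep_inl_inl, wordRep_inl_inl, map_permGL]
  · rw [MonoidHom.comp_apply, wordRep_inl_inr, wordRep_inl_inr, map]
  · rw [MonoidHom.comp_apply, wordRep_inr, wordRep_inr, map]

theorem rep_map (π : G →* Equiv.Perm (Fin n)) (f : R →+* R') (d : RepPoint R n T N) (w) :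
    (d.map f).rep π w = Matrix.GeneralLinearGroup.map f (d.rep π w) := by
  obtain ⟨w, c⟩ := w
  rw [rep_mk, rep_mk, wordRep_map, map_mul, MonoidHom.comp_apply,
    Matrix.GeneralLinearGroup.map_scalar]
  congr 3
  simp [zpowProd, map]

/-- This determinant is what is followed along a specialization: over a field it is nonzero exactly
when ρ(w) - 1 is invertible. -/
theorem det_rep_map_sub_one (π : G →* Equiv.Perm (Fin n)) (f : R →+* R') (d : RepPoint R n T N)
    (w) : (((d.map f).rep π w).val - 1).det = f (((d.rep π w).val - 1).det) := by
  rw [rep_map, RingHom.map_det, map_sub, map_one]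
  rfl

/-- The coordinates of a point. -/
def coord {m : ℕ} (e : T ≃ Fin m) (d : RepPoint R n T N) :
    (Fin m × Fin n × Fin n) ⊕ (Fin 4 × Fin n × Fin n) ⊕ Fin N → R
  | .inl p => (d.X (e.symm p.1)).val p.2.1 p.2.2
  | .inr (.inl p) => (d.Z p.1).val p.2.1 p.2.2
  | .inr (.inr k) => d.y k

theorem coord_injective {m : ℕ} (e : T ≃ Fin m) :
    Function.Injective (coord e : RepPoint R n T N → _) := by
  intro d d' h
  refine RepPoint.ext (funext fun t => Units.ext ?_) (funext fun a => Units.ext ?_)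
    (funext fun k => Units.ext ?_)
  · ext i j; simpa [coord] using congrFun h (.inl (e t, i, j))
  · ext i j; simpa [coord] using congrFun h (.inr (.inl (a, i, j)))
  · simpa [coord] using congrFun h (.inr (.inr k))

theorem coord_map {m : ℕ} (e : T ≃ Fin m) (f : R →+* R') (d : RepPoint R n T N) :
    (d.map f).coord e = f ∘ d.coord e := by
  funext p
  rcases p with p | p | k <;> rfl

/-- The determinants which are to be units. -/
def coordDet {m : ℕ} (x : (Fin m × Fin n × Fin n) ⊕ (Fin 4 × Fin n × Fin n) ⊕ Fin N → R) :
    Fin m ⊕ Fin 4 ⊕ Fin N → R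
  | .inl t => (Matrix.of fun i j => x (.inl (t, i, j))).det
  | .inr (.inl a) => (Matrix.of fun i j => x (.inr (.inl (a, i, j)))).det
  | .inr (.inr k) => x (.inr (.inr k))

theorem coordDet_comp {m : ℕ} (f : R →+* R')
    (x : (Fin m × Fin n × Fin n) ⊕ (Fin 4 × Fin n × Fin n) ⊕ Fin N → R) :
    coordDet (f ∘ x) = f ∘ coordDet x := by
  funext p
  rcases p with p | p | k
  · simp only [coordDet, Function.comp, RingHom.map_det]; rfl
  · simp only [coordDet, Function.comp, RingHom.map_det]; rfl
  · rfl

theorem isUnit_coordDet_coord {m : ℕ} (e : T ≃ Fin m) (d : RepPoint R n T N) (p) :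
    IsUnit (coordDet (d.coord e) p) := by
  rcases p with p | p | k
  · exact (Matrix.isUnit_iff_isUnit_det _).1 (d.X (e.symm p)).isUnit
  · exact (Matrix.isUnit_iff_isUnit_det _).1 (d.Z p).isUnit
  · exact (d.y k).isUnit

/-- Unit determinants are the only constraint on coordinates, so points can be built over the
fraction field and over a local ring from the same indeterminates. -/
theorem exists_coord_eq {m : ℕ} (e : T ≃ Fin m)
    (x : (Fin m × Fin n × Fin n) ⊕ (Fin 4 × Fin n × Fin n) ⊕ Fin N → R)
    (hx : ∀ p, IsUnit (coordDet x p)) : ∃ d : RepPoint R n T N, d.coord e = x := by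
  refine ⟨⟨fun t => Matrix.GeneralLinearGroup.mk'' (Matrix.of fun i j => x (.inl (e t, i, j)))
    (hx (.inl (e t))), fun a => Matrix.GeneralLinearGroup.mk''
      (Matrix.of fun i j => x (.inr (.inl (a, i, j)))) (hx (.inr (.inl a))),
    fun k => (hx (.inr (.inr k))).unit⟩, ?_⟩
  funext p
  rcases p with p | p | k
  · simp [coord, Matrix.GeneralLinearGroup.mk'', Matrix.nonsingInvUnit]
  · simp [coord, Matrix.GeneralLinearGroup.mk'', Matrix.nonsingInvUnit]
  · simp [coord, coordDet]

/-- There is a generic point: its matrices have algebraically independent entries, and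
`ρ(w) - 1` is invertible as soon as it is invertible at some other point. -/
theorem exists_generic [Finite T] (π : G →* Equiv.Perm (Fin n)) :
    ∃ (L : Type) (_ : Field L) (_ : Algebra ℂ L) (d : RepPoint L n T N),
      AlgebraicIndependent ℂ (fun p : T × Fin n × Fin n => (d.X p.1).val p.2.1 p.2.2) ∧
      ∀ (K : Type) [Field K] [Algebra ℂ K] (d' : RepPoint K n T N) (w : AugTarget G T N),
        IsUnit ((d'.rep π w).val - 1) → IsUnit ((d.rep π w).val - 1) := by
  obtain ⟨m, ⟨e⟩⟩ := Finite.exists_equiv_fin T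
  let V := (Fin m × Fin n × Fin n) ⊕ (Fin 4 × Fin n × Fin n) ⊕ Fin N
  let A := MvPolynomial V ℂ
  let L := FractionRing A
  let x : V → A := MvPolynomial.X
  have ev_x {K : Type} [Field K] [Algebra ℂ K] (d' : RepPoint K n T N) :
      (MvPolynomial.aeval (d'.coord e) : A →ₐ[ℂ] K).toRingHom ∘ x = d'.coord e := by
    funext p
    exact MvPolynomial.aeval_X _ p
  have det_ne {K : Type} [Field K] [Algebra ℂ K] (d' : RepPoint K n T N) (p) :
      (MvPolynomial.aeval (d'.coord e) : A →ₐ[ℂ] K).toRingHom (coordDet x p) ≠ 0 := by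
    have h := isUnit_coordDet_coord e d' p
    rw [← ev_x d', coordDet_comp] at h
    exact h.ne_zero
  have hinj : Function.Injective (algebraMap A L) := IsFractionRing.injective A L
  obtain ⟨d, hd⟩ := exists_coord_eq e (algebraMap A L ∘ x) fun p => by
    rw [coordDet_comp]
    refine isUnit_iff_ne_zero.2 fun h => ?_
    have h0 : coordDet x p = 0 := hinj (by rw [map_zero]; exact h)
    -- The generic determinants are nonzero polynomials because they do not vanish at the point with
    -- all matrices and scalars equal to 1.
    refine det_ne (K := ℂ) ⟨fun _ => 1, fun _ => 1, fun _ => 1⟩ p ?_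
    rw [h0, map_zero]
  refine ⟨L, inferInstance, inferInstance, d, ?_, ?_⟩
  · have h1 : AlgebraicIndependent ℂ (fun p : V => algebraMap A L (x p)) :=
      (MvPolynomial.algebraicIndependent_X V ℂ).map' (f := IsScalarTower.toAlgHom ℂ A L) hinj
    have h2 : Function.Injective
        (fun p : T × Fin n × Fin n => (Sum.inl (e p.1, p.2) : V)) := by
      rintro ⟨a, b⟩ ⟨a', b'⟩ h
      simpa using h
    have h3 : (fun p : T × Fin n × Fin n => (d.X p.1).val p.2.1 p.2.2) =
        (fun p : V => algebraMap A L (x p)) ∘ fun p => Sum.inl (e p.1, p.2) := by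
      funext p
      have := congrFun hd (Sum.inl (e p.1, p.2))
      simpa [coord] using this
    rw [h3]
    exact h1.comp _ h2
  · intro K _ _ d' w hw
    let ev : A →+* K := (MvPolynomial.aeval (d'.coord e) : A →ₐ[ℂ] K).toRingHom
    let I := RingHom.ker ev
    have hI : I.IsPrime := RingHom.ker_isPrime ev
    -- The entries of ρ(w) involve inverse matrices and need not be polynomials. They lie in the
    -- local ring B at d', which embeds in L and maps to K; a determinant that is nonzero in K is
    -- therefore nonzero in B and in L.
    let B := Localization.AtPrime I
    have hle : I.primeCompl ≤ nonZeroDivisors A := Ideal.primeCompl_le_nonZeroDivisors I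
    have hK : ∀ y : I.primeCompl, IsUnit (ev y) := fun y => isUnit_iff_ne_zero.2 y.2
    have hL : ∀ y : I.primeCompl, IsUnit (algebraMap A L y) := fun y =>
      isUnit_iff_ne_zero.2 fun h => nonZeroDivisors.ne_zero (hle y.2)
        (hinj (h.trans (map_zero _).symm))
    let jK : B →+* K := IsLocalization.lift hK
    let jL : B →+* L := IsLocalization.lift hL
    have hjK : ∀ a, jK (algebraMap A B a) = ev a := IsLocalization.lift_eq hK
    have hjL : ∀ a, jL (algebraMap A B a) = algebraMap A L a := IsLocalization.lift_eq hL
    have hjLinj : Function.Injective jL := by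
      refine (IsLocalization.lift_injective_iff hL).2 fun a b => ?_
      rw [hinj.eq_iff, (IsLocalization.injective B hle).eq_iff]
    obtain ⟨dB, hdB⟩ := exists_coord_eq e (algebraMap A B ∘ x) fun p => by
      rw [coordDet_comp]
      exact (IsLocalization.AtPrime.isUnit_to_map_iff B I _).2 (det_ne d' p)
    have h1 : dB.map jK = d' := by
      apply coord_injective e
      rw [coord_map, hdB, ← ev_x d']
      funext p
      exact hjK _
    have h2 : dB.map jL = d := by
      apply coord_injective e
      rw [coord_map, hdB, hd]
      funext p
      exact hjL _
    rw [Matrix.isUnit_iff_isUnit_det, isUnit_iff_ne_zero] at hw ⊢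
    rw [← h1, det_rep_map_sub_one] at hw
    rw [← h2, det_rep_map_sub_one]
    intro h0
    rw [(map_eq_zero_iff jL hjLinj).1 h0, map_zero] at hw
    exact hw rfl

end RepPoint

/-! ### Twisting the regular representation -/

/-- Write each element of H as c r with c in the cyclic group ⟨s⟩ and r in a transversal. Then f is
a character of ⟨s⟩, nontrivial at s, applied to c, and τ inverts c. -/
theorem exists_twist {H : Type u} [Group H] [Finite H] {s : H} (hs : s ≠ 1) :
    ∃ (ζ : ℂˣ) (f : H → ℂˣ) (τ : Equiv.Perm H), ζ ≠ 1 ∧ (∀ h, f (s * h) = ζ * f h) ∧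
      ∀ h, τ (s * h) = s⁻¹ * τ h := by
  let K := Subgroup.zpowers s
  obtain ⟨R, hR, -⟩ := Subgroup.exists_isComplement_right K 1
  let c : K := ⟨s, Subgroup.mem_zpowers s⟩
  have hc : c ≠ 1 := fun h => hs (congrArg Subtype.val h)
  let _ : CommGroup K := IsCyclic.commGroup
  obtain ⟨χ, hχ⟩ := CommGroup.exists_apply_ne_one_of_hasEnoughRootsOfUnity K ℂ hc
  have hmul : ∀ h, hR.equiv (s * h) = (c * (hR.equiv h).1, (hR.equiv h).2) :=
    fun h => hR.equiv_mul_left c h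
  refine ⟨χ c, fun h => χ (hR.equiv h).1,
    hR.equiv.trans (((Equiv.inv K).prodCongr (Equiv.refl R)).trans hR.equiv.symm), hχ, ?_, ?_⟩
  · intro h
    simp only [hmul, map_mul]
  · intro h
    apply hR.equiv.injective
    have h1 : ∀ k, hR.equiv (s⁻¹ * k) = (c⁻¹ * (hR.equiv k).1, (hR.equiv k).2) :=
      fun k => hR.equiv_mul_left c⁻¹ k
    rw [h1]
    simp [hmul, mul_comm]

/-- The left regular representation of `H`, on `Fin n`. -/
def regPerm {H : Type u} [Group H] {n : ℕ} (e : H ≃ Fin n) : H →* Equiv.Perm (Fin n) :=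
  e.permCongrHom.toMonoidHom.comp (MulAction.toPermHom H H)

theorem regPerm_apply {H : Type u} [Group H] {n : ℕ} (e : H ≃ Fin n) (h : H) (a : Fin n) :
    regPerm e h a = e (h * e.symm a) := rfl

/-- Translation is free, which supplies the derangements required by `SufficientlyGeneric`. -/
theorem regPerm_ne {H : Type u} [Group H] {n : ℕ} (e : H ≃ Fin n) {h : H} (hh : h ≠ 1)
    (a : Fin n) : regPerm e h a ≠ a := by
  intro h1
  rw [regPerm_apply] at h1
  have h2 : h * e.symm a = e.symm a := e.injective (by simpa using h1)
  exact hh (by simpa using h2)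

/-- In the regular representation, a nontrivial element is conjugate to a nontrivial scalar
multiple of itself, and to its inverse. -/
theorem exists_twist_matrix {H : Type u} [Group H] [Finite H] {s : H} (hs : s ≠ 1) {n : ℕ}
    (e : H ≃ Fin n) : ∃ (ζ : ℂˣ) (D M : Matrix.GeneralLinearGroup (Fin n) ℂ), ζ ≠ 1 ∧
      D * permGL ℂ n (regPerm e s) =
        Matrix.GeneralLinearGroup.scalar (Fin n) ζ * (permGL ℂ n (regPerm e s) * D) ∧
      M * permGL ℂ n (regPerm e s) = (permGL ℂ n (regPerm e s))⁻¹ * M := by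
  obtain ⟨ζ, f, τ, hζ, hf, hτ⟩ := exists_twist hs
  let D : Matrix.GeneralLinearGroup (Fin n) ℂ := Matrix.GeneralLinearGroup.mkOfDetNeZero
    (Matrix.diagonal fun a => (f (e.symm a) : ℂ)) (by
      rw [Matrix.det_diagonal]
      exact Finset.prod_ne_zero_iff.2 fun a _ => (f _).ne_zero)
  have hD : D.val = Matrix.diagonal fun a => (f (e.symm a) : ℂ) := rfl
  refine ⟨ζ, D, permGL ℂ n (e.permCongrHom τ), hζ, Units.ext ?_, ?_⟩
  · rw [Units.val_mul, Units.val_mul, Units.val_mul, hD, permGL_val,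
      Matrix.GeneralLinearGroup.coe_scalar]
    ext i j
    have h1 := hf (e.symm j)
    have h2 : (i = e (s * e.symm j)) ↔ ((regPerm e s)⁻¹ i = j) := by
      rw [← regPerm_apply, Equiv.Perm.inv_eq_iff_eq]
    simp only [Matrix.diagonal_mul, Matrix.scalar_apply, Matrix.mul_diagonal,
      PEquiv.toMatrix_apply, Equiv.toPEquiv_apply, Option.mem_def, Option.some.injEq]
    by_cases h : (regPerm e s)⁻¹ i = j
    · have h3 := h2.2 h
      simp only [if_pos h]
      rw [h3, Equiv.symm_apply_apply, h1]
      push_cast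
      ring
    · simp only [if_neg h, mul_zero, zero_mul]
  · rw [← map_inv, ← map_mul, ← map_mul]
    congr 1
    refine Equiv.ext fun a => ?_
    have h1 := hτ (e.symm a)
    rw [← map_inv, Equiv.Perm.mul_apply, Equiv.Perm.mul_apply, regPerm_apply, regPerm_apply]
    simp [Equiv.permCongrHom, h1]

/-! ### Invertibility of `A - 1` -/

namespace Matrix.GeneralLinearGroup

variable {n : ℕ} {L : Type*} [Field L]

/-- `A - 1` is invertible. -/
def UnitSubOne (A : GeneralLinearGroup (Fin n) L) : Prop := IsUnit (A.val - 1)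

theorem UnitSubOne.conj {A : GeneralLinearGroup (Fin n) L} (h : UnitSubOne A)
    (B : GeneralLinearGroup (Fin n) L) : UnitSubOne (B * A * B⁻¹) := by
  have h1 : (B * A * B⁻¹).val - 1 = B.val * (A.val - 1) * (B⁻¹).val := by
    rw [mul_sub, sub_mul, mul_one, ← Units.val_mul B B⁻¹, mul_inv_cancel]
    rfl
  rw [UnitSubOne, h1]
  exact (B.isUnit.mul h).mul B⁻¹.isUnit

theorem UnitSubOne.inv {A : GeneralLinearGroup (Fin n) L} (h : UnitSubOne A) :
    UnitSubOne A⁻¹ := by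
  have h1 : (A⁻¹).val - 1 = -((A⁻¹).val * (A.val - 1)) := by
    rw [mul_sub, ← Units.val_mul, inv_mul_cancel]
    simp
  rw [UnitSubOne, h1]
  exact (A⁻¹.isUnit.mul h).neg

theorem UnitSubOne.scalar {ζ : Lˣ} (h : ζ ≠ 1) : UnitSubOne (scalar (Fin n) ζ) := by
  have h1 : (GeneralLinearGroup.scalar (Fin n) ζ).val - 1 = Matrix.scalar (Fin n) (ζ.val - 1) := by
    rw [map_sub, map_one]; rfl
  rw [UnitSubOne, h1]
  exact (isUnit_iff_ne_zero.2 (sub_ne_zero.2 fun h2 => h (Units.ext h2))).map (Matrix.scalar (Fin n))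

/-- A - 1 divides A^k - 1, by the geometric sum. -/
theorem UnitSubOne.of_pow {A : GeneralLinearGroup (Fin n) L} {k : ℕ} (h : UnitSubOne (A ^ k)) :
    UnitSubOne A := by
  rw [UnitSubOne, Units.val_pow_eq_pow_val, ← mul_geom_sum] at h
  exact isUnit_of_mul_isUnit_left h

theorem UnitSubOne.mul_scalar {A : GeneralLinearGroup (Fin n) L} {ζ : Lˣ} {k : ℕ}
    (hA : A ^ k = 1) (hζ : ζ ^ k ≠ 1) : UnitSubOne (A * GeneralLinearGroup.scalar (Fin n) ζ) := by
  refine UnitSubOne.of_pow (k := k) ?_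
  rw [Commute.mul_pow (scalar_commute ζ A).symm, hA, one_mul, ← map_pow]
  exact UnitSubOne.scalar hζ

end Matrix.GeneralLinearGroup

/-! ### Generic representations -/

section Generic

variable {G : Type u} [Group G] {T : Type v} {N : ℕ}

/-- The word group `G ∗ F_T ∗ F_4`. -/
abbrev AugWord (G : Type u) [Group G] (T : Type v) : Type (max u v) :=
  Monoid.Coprod (Monoid.Coprod G (FreeGroup T)) (FreeGroup (Fin 4))

namespace AugWord

/-- The letter `z_a`. -/
def Z (a : Fin 4) : AugWord G T := Monoid.Coprod.inr (FreeGroup.of a)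

/-- The element given by `g ∈ G`. -/
def ofG : G →* AugWord G T := Monoid.Coprod.inl.comp Monoid.Coprod.inl

/-- Substitution for the letters `z_a`. -/
def subst (z : Fin 4 → AugWord G T) : AugWord G T →* AugWord G T :=
  Monoid.Coprod.lift Monoid.Coprod.inl (FreeGroup.lift z)

@[simp]
theorem subst_Z (z : Fin 4 → AugWord G T) (a : Fin 4) : subst z (Z a) = z a := by
  simp [subst, Z]

@[simp]
theorem subst_inl (z : Fin 4 → AugWord G T) (x : Monoid.Coprod G (FreeGroup T)) :
    subst z (Monoid.Coprod.inl x) = Monoid.Coprod.inl x := by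
  simp [subst]

@[simp]
theorem subst_ofG (z : Fin 4 → AugWord G T) (g : G) : subst z (ofG g) = ofG g := by
  simp [ofG]

/-- The abelianized component in the free group on `T`. -/
noncomputable def abT : AugWord G T →* Multiplicative (T →₀ ℤ) :=
  Monoid.Coprod.lift
    ((FreeGroup.lift fun r => Multiplicative.ofAdd (Finsupp.single r 1)).comp Monoid.Coprod.snd) 1

/-- The exponents of the letters `z_a`. -/
def abZ : AugWord G T →* Multiplicative (Fin 4 → ℤ) :=
  Monoid.Coprod.lift 1 (FreeGroup.lift fun a => Multiplicative.ofAdd (Pi.single a 1))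

@[simp] theorem abT_ofG (g : G) : abT (ofG g : AugWord G T) = 1 := by simp [abT, ofG]
@[simp] theorem abT_Z (a : Fin 4) : abT (Z a : AugWord G T) = 1 := by simp [abT, Z]
@[simp] theorem abZ_inl (x : Monoid.Coprod G (FreeGroup T)) :
    abZ (Monoid.Coprod.inl x : AugWord G T) = 1 := by simp [abZ]
@[simp] theorem abZ_ofG (g : G) : abZ (ofG g : AugWord G T) = 1 := by simp [ofG]
@[simp] theorem abZ_Z (a : Fin 4) :
    abZ (Z a : AugWord G T) = Multiplicative.ofAdd (Pi.single a 1) := by simp [abZ, Z]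

end AugWord

open AugWord Matrix.GeneralLinearGroup

/-- A representation which separates everything that the abelianization, or a substitution for
the letters `z_a`, separates. -/
structure IsGenericRep {n : ℕ} {L : Type} [Field L] (σ : G)
    (ρ : AugWord G T × Multiplicative (Fin N → ℤ) →* Matrix.GeneralLinearGroup (Fin n) L) :
    Prop where
  unit_of_abT : ∀ w, abT w.1 ≠ 1 → UnitSubOne (ρ w)
  unit_of_abZ : ∀ w, abZ w.1 ≠ 1 → UnitSubOne (ρ w)
  unit_of_snd : ∀ w, w.2 ≠ 1 → UnitSubOne (ρ w)
  unit_of_subst : ∀ z w, UnitSubOne (ρ (subst z w, 1)) → UnitSubOne (ρ (w, 1))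
  unit_or_of_sufficientlyGeneric : ∀ x, SufficientlyGeneric x →
    UnitSubOne (ρ (Monoid.Coprod.inl x, 1)) ∨ ρ (Monoid.Coprod.inl x, 1) = 1
  unit_comm : ∀ a, UnitSubOne (ρ (ofG σ * Z a * (ofG σ)⁻¹ * (Z a)⁻¹, 1))
  unit_twist : ∀ a, UnitSubOne (ρ (ofG σ * Z a * ofG σ * (Z a)⁻¹, 1))

/-- A homomorphism to `ℤ` that kills `G` detects elements at a point with scalar matrices. -/
theorem exists_repPoint_unitSubOne {n : ℕ} (π : G →* Equiv.Perm (Fin n))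
    (θ : AugWord G T × Multiplicative (Fin N → ℤ) →* Multiplicative ℤ)
    (hθ : ∀ g, θ (ofG g, 1) = 1) {w} (hw : θ w ≠ 1) :
    ∃ d : RepPoint ℂ n T N, UnitSubOne (d.rep π w) := by
  -- No nonzero power of 2 is a root of unity. With scalar matrices for the letters, ρ(w) is a
  -- permutation matrix, of finite order, times such a power.
  let two : ℂˣ := Units.mk0 2 two_ne_zero
  let χ : AugWord G T × Multiplicative (Fin N → ℤ) →* ℂˣ := (zpowersHom ℂˣ two).comp θ
  let d : RepPoint ℂ n T N :=
    ⟨fun t => scalar (Fin n) (χ (Monoid.Coprod.inl (Monoid.Coprod.inr (FreeGroup.of t)), 1)),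
      fun a => scalar (Fin n) (χ (Z a, 1)),
      fun m => χ (1, Multiplicative.ofAdd (Pi.single m 1))⟩
  let π' : AugWord G T →* Equiv.Perm (Fin n) := Monoid.Coprod.lift (Monoid.Coprod.lift π 1) 1
  let E : Equiv.Perm (Fin n) × ℂˣ →* Matrix.GeneralLinearGroup (Fin n) ℂ :=
    MonoidHom.noncommCoprod (permGL ℂ n) (scalar (Fin n)) fun _ _ => (scalar_commute _ _).symm
  have hE : ∀ τ c, E (τ, c) = permGL ℂ n τ * scalar (Fin n) c := fun _ _ => rfl
  have h1 : d.wordRep π = E.comp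
      (π'.prod (χ.comp (MonoidHom.inl _ _))) := by
    refine RepPoint.wordRep_hom_ext (fun x => ?_) (fun t => ?_) (fun a => ?_)
    · have : χ (Monoid.Coprod.inl (Monoid.Coprod.inl x), 1) = 1 := by
        change zpowersHom ℂˣ two (θ (ofG x, 1)) = 1
        rw [hθ, map_one]
      simp [π', this, hE]
    · simp [π', d, hE]
    · simp [π', d, Z, hE]
  have h2 : zpowProd d.y = χ.comp (MonoidHom.inr _ _) := by
    refine MonoidHom.ext fun c => ?_
    have hc : c = ∏ m, (Multiplicative.ofAdd (Pi.single m (1 : ℤ) : Fin N → ℤ)) ^ c.toAdd m := by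
      apply Multiplicative.toAdd.injective
      rw [toAdd_prod]
      funext i
      simp [Finset.sum_apply, Pi.single_apply]
    conv_rhs => rw [hc, map_prod]
    simp only [map_zpow]
    rfl
  refine ⟨d, ?_⟩
  obtain ⟨w, c⟩ := w
  have h3 : d.rep π (w, c) = permGL ℂ n (π' w) * scalar (Fin n) (χ (w, c)) := by
    have h4 : (w, c) = ((w, 1) * (1, c) : AugWord G T × Multiplicative (Fin N → ℤ)) := by simp
    conv_rhs => rw [h4, map_mul χ, map_mul]
    rw [RepPoint.rep_mk, h1, h2, ← mul_assoc]
    rfl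
  rw [h3]
  refine UnitSubOne.mul_scalar (k := orderOf (π' w)) ?_ ?_
  · rw [← map_pow, pow_orderOf_eq_one, map_one]
  · intro h
    have hpos : orderOf (π' w) ≠ 0 := (orderOf_pos _).ne'
    have h5 : (χ (w, c)).val = (2 : ℂ) ^ (θ (w, c)).toAdd := by
      simp [χ, two, zpowersHom_apply]
    have h6 := congrArg (fun u : ℂˣ => ‖u.val‖) h
    simp only [Units.val_pow_eq_pow_val, Units.val_one, norm_pow, norm_one, h5, norm_zpow,
      Complex.norm_ofNat] at h6
    have h7 : ((2 : ℝ) ^ (θ (w, c)).toAdd) = 1 :=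
      (pow_eq_one_iff_of_nonneg (by positivity) hpos).1 h6
    have h8 := (zpow_eq_one_iff_right₀ (by norm_num : (0 : ℝ) ≤ 2) (by norm_num)).1 h7
    exact hw h8

/-- The representation is the generic point over the regular representation of H. Each invertibility
requirement needs only one specialization where it holds. -/
theorem exists_isGenericRep [Finite T] {H : Type} [Group H] [Finite H] (q : G →* H) {σ : G}
    (hσ : q σ ≠ 1) : ∃ (n : ℕ) (_ : 1 ≤ n) (L : Type) (_ : Field L) (_ : Algebra ℂ L)
      (ρ : AugWord G T × Multiplicative (Fin N → ℤ) →* Matrix.GeneralLinearGroup (Fin n) L),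
      IsGenericRep σ ρ := by
  let n := Nat.card H
  let e : H ≃ Fin n := Finite.equivFin H
  let π : G →* Equiv.Perm (Fin n) := (regPerm e).comp q
  obtain ⟨L, _, _, d, hd, hspec⟩ := RepPoint.exists_generic (N := N) (T := T) π
  have hab : ∀ θ : AugWord G T × Multiplicative (Fin N → ℤ) →* Multiplicative ℤ,
      (∀ g, θ (ofG g, 1) = 1) → ∀ w, θ w ≠ 1 → UnitSubOne (d.rep π w) := by
    intro θ hθ w hw
    obtain ⟨d', hd'⟩ := exists_repPoint_unitSubOne π θ hθ hw
    exact hspec ℂ d' w hd'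
  obtain ⟨ζ, A, M, hζ, hA, hM⟩ := exists_twist_matrix hσ e
  set p := permGL ℂ n (regPerm e (q σ)) with hp
  have hπ : permGL ℂ n (π σ) = p := rfl
  have hunit : UnitSubOne (scalar (Fin n) ζ)⁻¹ := (UnitSubOne.scalar hζ).inv
  have hA' : p * A * p⁻¹ * A⁻¹ = (scalar (Fin n) ζ)⁻¹ := by
    rw [eq_inv_iff_mul_eq_one, ← scalar_commute]
    have h : scalar (Fin n) ζ * (p * A * p⁻¹ * A⁻¹) = scalar (Fin n) ζ * (p * A) * p⁻¹ * A⁻¹ := by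
      group
    rw [h, ← hA]
    group
  refine ⟨n, Nat.card_pos, L, inferInstance, inferInstance, d.rep π, ?_, ?_, ?_, ?_, ?_, ?_, ?_⟩
  · intro w hw
    obtain ⟨t, ht⟩ : ∃ t, (abT w.1).toAdd t ≠ 0 := by
      by_contra! h
      exact hw (Multiplicative.toAdd.injective (Finsupp.ext h))
    exact hab (((AddMonoidHom.toMultiplicative (Finsupp.applyAddHom t)).comp abT).comp
      (MonoidHom.fst _ _)) (fun g => by simp) w fun h => ht (congrArg Multiplicative.toAdd h)
  · intro w hw
    obtain ⟨t, ht⟩ : ∃ t, (abZ w.1).toAdd t ≠ 0 := by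
      by_contra! h
      exact hw (Multiplicative.toAdd.injective (funext h))
    exact hab (((AddMonoidHom.toMultiplicative (Pi.evalAddMonoidHom _ t)).comp abZ).comp
      (MonoidHom.fst _ _)) (fun g => by simp) w fun h => ht (congrArg Multiplicative.toAdd h)
  · intro w hw
    obtain ⟨t, ht⟩ : ∃ t, (w.2).toAdd t ≠ 0 := by
      by_contra! h
      exact hw (Multiplicative.toAdd.injective (funext h))
    exact hab ((AddMonoidHom.toMultiplicative (Pi.evalAddMonoidHom _ t)).comp
      (MonoidHom.snd _ _)) (fun g => by simp) w fun h => ht (congrArg Multiplicative.toAdd h)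
  · intro z w hw
    -- Substitution in words is specialization of matrices: the letters z_a take the generic values
    -- of the words substituted for them.
    let d' : RepPoint L n T N := ⟨d.X, fun a => d.wordRep π (z a), d.y⟩
    have h : d'.wordRep π = (d.wordRep π).comp (subst z) := by
      refine RepPoint.wordRep_hom_ext (fun x => ?_) (fun t => ?_) (fun a => ?_)
      · simp
      · simp [d']
      · simpa [d', Z] using congrArg (d.wordRep π) (subst_Z z a).symm
    refine hspec L d' _ ?_
    have h' : d'.rep π (w, 1) = d.rep π (subst z w, 1) := by
      rw [RepPoint.rep_mk, RepPoint.rep_mk, h, map_one, map_one]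
      rfl
    rw [h']
    exact hw
  · intro x hx
    have h := hx L n (((d.rep π).comp (MonoidHom.inl _ _)).comp Monoid.Coprod.inl) ?_ ?_
    · exact h.imp id fun h => Units.ext (sub_eq_zero.1 h)
    · intro g
      have hg : (((d.rep π).comp (MonoidHom.inl _ _)).comp Monoid.Coprod.inl)
          (Monoid.Coprod.inl g) = permGL L n (π g) := by
        simp [RepPoint.rep_mk]
      rw [hg]
      by_cases h1 : q g = 1
      · left
        simp [π, h1]
      · refine Or.inr ⟨(π g)⁻¹, fun a ha => ?_, rfl⟩
        rw [Equiv.Perm.inv_eq_iff_eq] at ha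
        exact regPerm_ne e h1 a ha.symm
    · convert hd using 4
      simp [RepPoint.rep_mk]
  · intro a
    refine hspec ℂ ⟨fun _ => 1, fun _ => A, fun _ => 1⟩ _ ?_
    change UnitSubOne _
    convert hunit using 1
    rw [← hA', ← hπ]
    simp [RepPoint.rep_mk, ofG, Z]
  · intro a
    -- M conjugates p to p⁻¹, so p (AM) p (AM)⁻¹ collapses to the commutator of p and A, a
    -- nontrivial scalar.
    refine hspec ℂ ⟨fun _ => 1, fun _ => A * M, fun _ => 1⟩ _ ?_
    change UnitSubOne _
    convert hunit using 1
    have h : p * (A * M) * p * (A * M)⁻¹ = (scalar (Fin n) ζ)⁻¹ := by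
      rw [← hA', mul_assoc p (A * M) p, mul_assoc A M p, hM]
      group
    rw [← h, ← hπ]
    simp [RepPoint.rep_mk, ofG, Z]

end Generic

/-! ### Symmetric triangular presentations -/

namespace SymTriPres

variable {S : Type u} (P : SymTriPres S)

theorem gen_e : P.gen P.e = 1 :=
  PresentedGroup.one_of_mem (Or.inl rfl)

variable {P}

theorem gen_mul_gen_mul_gen {a b c : S} (h : (a, b, c) ∈ P.rel) :
    P.gen a * P.gen b * P.gen c = 1 :=
  PresentedGroup.one_of_mem (rels := P.relWords) (Or.inr ⟨a, b, c, h, rfl⟩)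

theorem gen_inv (a : S) : P.gen (P.inv a) = (P.gen a)⁻¹ := by
  by_cases h : a = P.e
  · rw [h, P.inv_e, gen_e, inv_one]
  · have h1 := gen_mul_gen_mul_gen (P.inv_mem a h)
    rw [gen_e, mul_one] at h1
    exact (inv_eq_of_mul_eq_one_right h1).symm

variable (P) in
theorem closure_range_gen : Subgroup.closure (Set.range P.gen) = ⊤ :=
  PresentedGroup.closure_range_of P.relWords

/-- A homomorphism out of `⟨S ∣ R⟩`. -/
def lift {K : Type*} [Group K] (f : S → K) (he : f P.e = 1)
    (h : ∀ a b c, (a, b, c) ∈ P.rel → f a * f b * f c = 1) : P.Grp →* K :=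
  PresentedGroup.toGroup (f := f) (by
    rintro w (rfl | ⟨a, b, c, habc, rfl⟩)
    · simpa using he
    · simpa using h a b c habc)

theorem lift_gen {K : Type*} [Group K] (f : S → K) (he : f P.e = 1)
    (h : ∀ a b c, (a, b, c) ∈ P.rel → f a * f b * f c = 1) (s : S) :
    lift f he h (P.gen s) = f s :=
  PresentedGroup.toGroup.of _

end SymTriPres

/-! ### Evaluation of the augmentation in (G ∗ F_R ∗ F_4) × ℤ^N. -/

namespace Scrambling

open AugWord AugGen AugSym

variable {S : Type u} {T : Type v} {P : SymTriPres S} {Q : SymTriPres T}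
variable (D : Scrambling P Q) (s : S) {r : ℕ} (k : Fin r → Fin D.N) (ε : Fin r → ℤˣ)

/-- The value of an element of `⟨S' ∣ R'⟩` in `(G ∗ F_R ∗ F_4) × ℤ^N`. -/
def oldHom : Q.Grp →* AugWord P.Grp P.rel × Multiplicative (Fin D.N → ℤ) :=
  (MonoidHom.prodMap Monoid.Coprod.inl (MonoidHom.id _)).comp D.μ.toMonoidHom

theorem oldHom_apply (x : Q.Grp) :
    D.oldHom x = (Monoid.Coprod.inl (D.μ x).1, (D.μ x).2) := rfl

/-- The `ℤ^N`-part of `s'`. -/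
def cen : Fin D.N → ℤ := ScrTarget.piZ (D.μ (Q.gen (D.i s)))

/-- The first component comes from G, and its projection to G identifies it as s. -/
theorem μ_i_eq : D.μ (Q.gen (D.i s)) =
    (Monoid.Coprod.inl (P.gen s), Multiplicative.ofAdd (D.cen s)) := by
  obtain ⟨g, hg⟩ := D.μ_i s
  have h := D.piG_i s
  have h2 : g = P.gen s := by
    rw [← h]
    simp [ScrTarget.piG, hg]
  rw [← h2, ← hg]
  rfl

theorem oldHom_i : D.oldHom (Q.gen (D.i s)) =
    (ofG (P.gen s), Multiplicative.ofAdd (D.cen s)) := by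
  rw [oldHom_apply, μ_i_eq]
  rfl

theorem oldHom_j (m : Fin D.N) :
    D.oldHom (Q.gen (D.j m)) = (1, Multiplicative.ofAdd (D.b m)) := by
  rw [oldHom_apply, D.μ_j, map_one]

theorem oldHom_bPow (m : Fin D.N) (e : ℤˣ) :
    D.oldHom (Q.gen (D.bPow m e)) = (1, Multiplicative.ofAdd ((e : ℤ) • D.b m)) := by
  rcases Int.units_eq_one_or e with rfl | rfl
  · simp [bPow, oldHom_j]
  · simp [bPow, SymTriPres.gen_inv, oldHom_j]

/-- The `ℤ^N`-part of `p_l`. -/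
noncomputable def gam (l : ℕ) : Fin D.N → ℤ :=
  D.cen s + D.cen s + ∑ i : Fin r, if i.val < l then (ε i : ℤ) • D.b (k i) else 0

theorem gam_zero : D.gam s k ε 0 = D.cen s + D.cen s := by simp [gam]

theorem gam_succ (l : Fin r) :
    D.gam s k ε (l + 1) = D.gam s k ε l + (ε l : ℤ) • D.b (k l) := by
  rw [gam, gam, add_assoc (D.cen s + D.cen s)]
  congr 1
  have h : ∀ i : Fin r, (if i.val < l.val + 1 then (ε i : ℤ) • D.b (k i) else 0) =
      (if i.val < l.val then (ε i : ℤ) • D.b (k i) else 0) +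
        if i = l then (ε i : ℤ) • D.b (k i) else 0 := by
    intro i
    rcases lt_trichotomy i l with h | h | h
    · have h' : i.val < l.val := h
      simp [h.ne, h', Nat.lt_succ_of_lt h']
    · simp [h]
    · have h' : l.val < i.val := h
      rw [if_neg (by omega), if_neg (by omega), if_neg h.ne', add_zero]
  simp_rw [h, Finset.sum_add_distrib]
  simp

theorem gam_last {k : Fin r → Fin D.N} {ε : Fin r → ℤˣ} (h : D.IsExpression s k ε) :
    D.gam s k ε r = 0 := by
  have h1 : ∑ l, (ε l : ℤ) • D.b (k l) = (-2 : ℤ) • D.cen s := h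
  simp only [gam, Fin.is_lt, if_true, h1]
  abel

/-- The word of a new symbol. -/
def symWord : AugSym D.N r → AugWord P.Grp P.rel
  | z a => Z a
  | u a _ => Z a
  | v1 => Z 2 * ofG (P.gen s)
  | v2 => Z 2 * ofG (P.gen s) * Z 0
  | v3 => Z 2 * ofG (P.gen s) * Z 0 * ofG (P.gen s)
  | p l => ofG (P.gen s) * Z 0 * ofG (P.gen s) * Z 1 ^ l.val
  | q l => ofG (P.gen s) * Z 0 * ofG (P.gen s) * Z 1 ^ (l.val + 1)
  | w l => Z 3 * ofG (P.gen s) * Z 0 * ofG (P.gen s) * Z 1 ^ (r - l.val)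
  | t => ofG (P.gen s) * Z 0 * ofG (P.gen s)

/-- The `ℤ^N`-part of a new symbol. -/
noncomputable def symCen : AugSym D.N r → Fin D.N → ℤ
  | z _ => 0
  | u _ m => D.b m
  | v1 => D.cen s
  | v2 => D.cen s
  | v3 => D.cen s + D.cen s
  | p l => D.gam s k ε l
  | q l => D.gam s k ε l
  | w _ => 0
  | t => 0

/-- The value of a new symbol in `(G ∗ F_R ∗ F_4) × ℤ^N`. -/
noncomputable def symVal (y : AugSym D.N r) : AugWord P.Grp P.rel × Multiplicative (Fin D.N → ℤ) :=
  (D.symWord s y, Multiplicative.ofAdd (D.symCen s k ε y))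

/-- The value of a generator of the augmentation in `(G ∗ F_R ∗ F_4) × ℤ^N`. -/
noncomputable def augVal : AugGen T D.N r → AugWord P.Grp P.rel × Multiplicative (Fin D.N → ℤ)
  | old x => D.oldHom (Q.gen x)
  | pos y => D.symVal s k ε y
  | neg y => (D.symVal s k ε y)⁻¹

theorem augVal_inv (x : AugGen T D.N r) :
    D.augVal s k ε (x.inv Q.inv) = (D.augVal s k ε x)⁻¹ := by
  cases x with
  | old x => simp [AugGen.inv, augVal, SymTriPres.gen_inv]
  | pos y => rfl
  | neg y => simp [AugGen.inv, augVal]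

variable {k ε}

/-- Words and central parts are checked separately. The expression of -2π_ℤ(s') enters only through
w₀ = z₄ p_r, where the central part of p_r must vanish. -/
theorem augVal_of_augRel (hexp : D.IsExpression s k ε) {a b c : AugGen T D.N r}
    (h : AugRel D s k ε a b c) :
    D.augVal s k ε a * D.augVal s k ε b * D.augVal s k ε c = 1 := by
  cases h with
  | old_rel h =>
    simp only [augVal]
    rw [← map_mul, ← map_mul, SymTriPres.gen_mul_gen_mul_gen h, map_one]
  | pos_neg y => simp [augVal, SymTriPres.gen_e]
  | neg_pos y => simp [augVal, SymTriPres.gen_e]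
  | u_def a m => refine Prod.ext ?_ ?_ <;> simp [augVal, symVal, symWord, symCen, oldHom_j]
  | u_comm a m =>
    refine Prod.ext ?_ ?_ <;> simp [augVal, symVal, symWord, symCen, oldHom_j, SymTriPres.gen_inv]
  | v1_def => refine Prod.ext ?_ ?_ <;> simp [augVal, symVal, symWord, symCen, oldHom_i]
  | v2_def => refine Prod.ext ?_ ?_ <;> simp [augVal, symVal, symWord, symCen]
  | v3_def =>
    refine Prod.ext ?_ ?_
    · simp [augVal, symVal, symWord, symCen, oldHom_i]
    · simp only [augVal, symVal, symCen, oldHom_i, Prod.snd_mul, Prod.snd_inv, ← ofAdd_add,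
        ← ofAdd_neg, Prod.snd_one, ofAdd_eq_one]
      abel
  | p_zero =>
    refine Prod.ext ?_ ?_
    · simp [augVal, symVal, symWord, symCen, mul_assoc]
    · simp [augVal, symVal, symWord, symCen, gam_zero]
  | q_def l =>
    refine Prod.ext ?_ ?_
    · simp [augVal, symVal, symWord, symCen, mul_assoc, pow_succ]
    · simp [augVal, symVal, symWord, symCen]
  | p_succ l =>
    refine Prod.ext ?_ ?_
    · simp [augVal, symVal, symWord, symCen, oldHom_bPow]
    · simp only [augVal, symVal, symCen, oldHom_bPow, Prod.snd_mul, Prod.snd_inv, ← ofAdd_add,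
        ← ofAdd_neg, Prod.snd_one, ofAdd_eq_one, Fin.val_succ, gam_succ]
      abel
  | w_zero =>
    refine Prod.ext ?_ ?_
    · simp [augVal, symVal, symWord, symCen, mul_assoc]
    · simp [augVal, symVal, symWord, symCen, gam_last D s hexp]
  | w_succ l =>
    refine Prod.ext ?_ ?_
    -- This removes the truncated subtraction in the exponents r - l and r - (l + 1).
    · obtain ⟨m, hm⟩ : ∃ m, r = l.val + 1 + m := Nat.exists_eq_add_of_le l.2
      have h1 : r - l.val = m + 1 := by omega
      have h2 : r - (l.val + 1) = m := by omega
      simp [augVal, symVal, symWord, symCen, h1, h2, mul_assoc, pow_succ]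
    · simp [augVal, symVal, symWord, symCen]
  | t_def => refine Prod.ext ?_ ?_ <;> simp [augVal, symVal, symWord, symCen, mul_assoc]

theorem augVal_of_augRelSym (hexp : D.IsExpression s k ε) {a b c : AugGen T D.N r}
    (h : AugRelSym D s k ε a b c) :
    D.augVal s k ε a * D.augVal s k ε b * D.augVal s k ε c = 1 := by
  induction h with
  | base h => exact augVal_of_augRel D s hexp h
  | cyc _ ih => exact mul_eq_one_comm.1 (by rwa [mul_assoc] at ih)
  | rev _ ih =>
    rw [augVal_inv, augVal_inv, augVal_inv, ← mul_inv_rev, ← mul_inv_rev, ← mul_assoc, ih,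
      inv_one]

/-- The homomorphism from the augmentation to `(G ∗ F_R ∗ F_4) × ℤ^N`. -/
noncomputable def augHom (hexp : D.IsExpression s k ε) : (D.augmentation s k ε).Grp →*
    AugWord P.Grp P.rel × Multiplicative (Fin D.N → ℤ) :=
  SymTriPres.lift (D.augVal s k ε)
    (by change D.oldHom (Q.gen Q.e) = 1; rw [SymTriPres.gen_e, map_one])
    fun _ _ _ h => augVal_of_augRelSym D s hexp h

theorem augHom_gen (hexp : D.IsExpression s k ε) (x) :
    D.augHom s hexp ((D.augmentation s k ε).gen x) = D.augVal s k ε x :=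
  SymTriPres.lift_gen _ _ _ _

end Scrambling

open AugWord Matrix.GeneralLinearGroup

/-! ### The words of the new symbols -/

/-- The words that occur among the new symbols. The shapes `T` and `P 0` have the same word, but
are distinguished by the central part of the symbol. -/
inductive AugShape : Type
  | Z (a : Fin 4)
  | V1
  | V2
  | V3
  | P (i : ℕ)
  | W (i : ℕ)
  | T

namespace AugShape

/-- The exponents of the letters `z_a` in the word of a shape. -/
def deg : AugShape → Fin 4 → ℤ
  | Z a => Pi.single a 1
  | V1 => ![0, 0, 1, 0]
  | V2 => ![1, 0, 1, 0]
  | V3 => ![1, 0, 1, 0]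
  | P i => ![1, i, 0, 0]
  | W i => ![1, i, 0, 1]
  | T => ![1, 0, 0, 0]

variable {G : Type u} [Group G] {F : Type v}

/-- The word of a shape. -/
def word (σ : G) : AugShape → AugWord G F
  | Z a => AugWord.Z a
  | V1 => AugWord.Z 2 * ofG σ
  | V2 => AugWord.Z 2 * ofG σ * AugWord.Z 0
  | V3 => AugWord.Z 2 * ofG σ * AugWord.Z 0 * ofG σ
  | P i => ofG σ * AugWord.Z 0 * ofG σ * AugWord.Z 1 ^ i
  | W i => AugWord.Z 3 * ofG σ * AugWord.Z 0 * ofG σ * AugWord.Z 1 ^ i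
  | T => ofG σ * AugWord.Z 0 * ofG σ

theorem abZ_word (σ : G) (x : AugShape) :
    abZ (x.word σ : AugWord G F) = Multiplicative.ofAdd x.deg := by
  cases x <;> simp only [word, deg, map_mul, map_pow, abZ_Z, abZ_ofG, mul_one, one_mul,
    ← ofAdd_add, ← ofAdd_nsmul] <;> congr 1 <;> funext a <;> fin_cases a <;> simp

/-- Positivity of the total exponent rules out cancellation between old generators and unbalanced
numbers of new symbols and inverses. -/
theorem deg_sum_pos (x : AugShape) : 0 < ∑ a, x.deg a := by
  cases x with
  | Z a => simp [deg]
  | _ => simp [deg, Fin.sum_univ_four] <;> positivity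

/-- The pairs of different shapes with the same exponents. -/
theorem eq_of_deg_eq {x y : AugShape} (h : x.deg = y.deg) : x = y ∨
    (x = V1 ∧ y = Z 2 ∨ y = V1 ∧ x = Z 2) ∨ (x = V3 ∧ y = V2 ∨ y = V3 ∧ x = V2) ∨
    (x = P 0 ∧ y = T ∨ y = P 0 ∧ x = T) ∨ (x = P 0 ∧ y = Z 0 ∨ y = P 0 ∧ x = Z 0) ∨
    (x = T ∧ y = Z 0 ∨ y = T ∧ x = Z 0) := by
  have h0 := congrFun h 0
  have h1 := congrFun h 1
  have h2 := congrFun h 2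
  have h3 := congrFun h 3
  clear h
  rcases x with a | _ | _ | _ | i | i | _ <;> rcases y with b | _ | _ | _ | j | j | _ <;>
    try fin_cases a
  all_goals try fin_cases b
  all_goals simp [deg] at h0 h1 h2 h3
  all_goals simp
  all_goals omega

end AugShape

namespace AugShape

/-- The triples of shapes whose exponents add up, up to the order of the first two. -/
def AddTriple (x y z : AugShape) : Prop :=
  z = V2 ∧ (x = V1 ∧ (y = Z 0 ∨ y = P 0 ∨ y = T) ∨ x = Z 2 ∧ (y = Z 0 ∨ y = P 0 ∨ y = T)) ∨
  z = V3 ∧ (x = Z 2 ∧ (y = Z 0 ∨ y = P 0 ∨ y = T) ∨ x = V1 ∧ (y = Z 0 ∨ y = P 0 ∨ y = T)) ∨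
  (∃ i, z = P (i + 1) ∧ x = P i ∧ y = Z 1) ∨
  (z = P 1 ∧ (x = Z 0 ∨ x = T) ∧ y = Z 1) ∨
  (∃ i, z = W i ∧ x = Z 3 ∧ y = P i) ∨
  (z = W 0 ∧ x = Z 3 ∧ (y = Z 0 ∨ y = T)) ∨
  (∃ i, z = W (i + 1) ∧ x = W i ∧ y = Z 1)

theorem addTriple_of_deg_add_eq {x y z : AugShape} (h : x.deg + y.deg = z.deg) :
    AddTriple x y z ∨ AddTriple y x z := by
  have h0 := congrFun h 0
  have h1 := congrFun h 1
  have h2 := congrFun h 2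
  have h3 := congrFun h 3
  clear h
  rcases x with a | _ | _ | _ | i | i | _ <;> rcases y with b | _ | _ | _ | j | j | _ <;>
    rcases z with c | _ | _ | _ | l | l | _ <;> try fin_cases a
  all_goals try fin_cases b
  all_goals try fin_cases c
  all_goals simp [deg] at h0 h1 h2 h3
  all_goals try (exfalso; omega)
  all_goals simp [AddTriple]
  all_goals omega

end AugShape

/-! ### Products of the words under a generic representation. -/

section Words

variable {G : Type u} [Group G] {F : Type v} {N n : ℕ} {L : Type} [Field L] {σ : G}
  {ρ : AugWord G F × Multiplicative (Fin N → ℤ) →* Matrix.GeneralLinearGroup (Fin n) L}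

/-- `ρ(w) - 1` is invertible or zero. -/
def UnitOrOne (ρ : AugWord G F × Multiplicative (Fin N → ℤ) →*
    Matrix.GeneralLinearGroup (Fin n) L) (w : AugWord G F × Multiplicative (Fin N → ℤ)) : Prop :=
  UnitSubOne (ρ w) ∨ ρ w = 1

theorem UnitOrOne.inv {w} (h : UnitOrOne ρ w) : UnitOrOne ρ w⁻¹ := by
  rw [UnitOrOne, map_inv]
  exact h.imp UnitSubOne.inv inv_eq_one.2

theorem UnitOrOne.cyc {a b} (h : UnitOrOne ρ (a * b)) : UnitOrOne ρ (b * a) := by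
  have h1 : ρ (b * a) = (ρ a)⁻¹ * ρ (a * b) * (ρ a)⁻¹⁻¹ := by
    rw [map_mul, map_mul]
    group
  rw [UnitOrOne, h1]
  refine h.imp (fun h => h.conj _) fun h => ?_
  rw [h]
  group

/-- `ρ(w) - 1` is invertible, for a word `w`. -/
def UnitWord (ρ : AugWord G F × Multiplicative (Fin N → ℤ) →*
    Matrix.GeneralLinearGroup (Fin n) L) (w : AugWord G F) : Prop :=
  UnitSubOne (ρ (w, 1))

theorem UnitWord.conj {w w' : AugWord G F} (h : UnitWord ρ w) (g : AugWord G F)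
    (hw : g * w * g⁻¹ = w') : UnitWord ρ w' := by
  have h1 : ((w', 1) : AugWord G F × Multiplicative (Fin N → ℤ)) =
      (g, 1) * (w, 1) * (g, 1)⁻¹ := by
    simp [hw]
  rw [UnitWord, h1, map_mul, map_mul, map_inv]
  exact UnitSubOne.conj h _

theorem UnitWord.inv {w w' : AugWord G F} (h : UnitWord ρ w) (hw : w⁻¹ = w') :
    UnitWord ρ w' := by
  have h1 : ((w', 1) : AugWord G F × Multiplicative (Fin N → ℤ)) = (w, 1)⁻¹ := by
    simp [hw]
  rw [UnitWord, h1, map_inv]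
  exact UnitSubOne.inv h

namespace IsGenericRep

theorem comm (hρ : IsGenericRep σ ρ) (a : Fin 4) : UnitWord ρ (ofG σ * Z a * (ofG σ)⁻¹ * (Z a)⁻¹) := hρ.unit_comm a

theorem comm' (hρ : IsGenericRep σ ρ) (a : Fin 4) : UnitWord ρ (Z a * ofG σ * (Z a)⁻¹ * (ofG σ)⁻¹) :=
  (hρ.comm a).inv (by group)

theorem twist (hρ : IsGenericRep σ ρ) (a : Fin 4) : UnitWord ρ (ofG σ * Z a * ofG σ * (Z a)⁻¹) := hρ.unit_twist a

theorem twist' (hρ : IsGenericRep σ ρ) (a : Fin 4) : UnitWord ρ (Z a * (ofG σ)⁻¹ * (Z a)⁻¹ * (ofG σ)⁻¹) :=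
  (hρ.twist a).inv (by group)

theorem subst (hρ : IsGenericRep σ ρ) {w w' : AugWord G F} (z : Fin 4 → AugWord G F) (h : UnitWord ρ w')
    (hw : AugWord.subst z w = w') : UnitWord ρ w :=
  hρ.unit_of_subst z w (by rw [hw]; exact h)

end IsGenericRep

/-- The triples of shapes for which the product of the words is not covered by generic matrices.
They do not occur, by the central parts. -/
inductive BadTriple : AugShape → AugShape → AugShape → Prop
  | z_z : BadTriple (.Z 2) (.Z 0) .V2
  | z_p : BadTriple (.Z 2) (.P 0) .V2
  | z_t : BadTriple (.Z 2) .T .V2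
  | v_z : BadTriple .V1 (.Z 0) .V3
  | v_p : BadTriple .V1 (.P 0) .V3
  | v_t : BadTriple .V1 .T .V3

/-- Every triple with matching exponents that is not excluded gives the trivial word, or becomes a
commutator or twisted commutator of σ with one letter after a conjugation or a substitution of 1,
σ⁻¹ for the other letters. -/
theorem IsGenericRep.unitOrOne_word (hρ : IsGenericRep σ ρ) {x y z : AugShape}
    (h : x.deg + y.deg = z.deg) (h₁ : ¬ BadTriple x y z) (h₂ : ¬ BadTriple y x z) :
    UnitWord ρ (x.word σ * y.word σ * (z.word σ)⁻¹) ∨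
      (x.word σ * y.word σ * (z.word σ)⁻¹ : AugWord G F) = 1 := by
  obtain ⟨x', y', hxy, hz⟩ : ∃ x' y', (x = x' ∧ y = y' ∨ x = y' ∧ y = x') ∧
      AugShape.AddTriple x' y' z := by
    rcases AugShape.addTriple_of_deg_add_eq h with h | h
    · exact ⟨x, y, .inl ⟨rfl, rfl⟩, h⟩
    · exact ⟨y, x, .inr ⟨rfl, rfl⟩, h⟩
  rcases hz with ⟨rfl, ⟨rfl, rfl | rfl | rfl⟩ | ⟨rfl, rfl | rfl | rfl⟩⟩ |
    ⟨rfl, ⟨rfl, rfl | rfl | rfl⟩ | ⟨rfl, rfl | rfl | rfl⟩⟩ | ⟨i, rfl, rfl, rfl⟩ |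
    ⟨rfl, rfl | rfl, rfl⟩ | ⟨i, rfl, rfl, rfl⟩ | ⟨rfl, rfl, rfl | rfl⟩ | ⟨i, rfl, rfl, rfl⟩ <;>
    rcases hxy with ⟨rfl, rfl⟩ | ⟨rfl, rfl⟩ <;> simp only [AugShape.word]
  · right; group
  · exact .inl (hρ.subst ![Z 0, 1, 1, 1] (hρ.comm' 0) (by simp [mul_assoc]))
  · exact .inl ((hρ.twist 0).conj (Z 2 * ofG σ) (by group))
  -- The choice z₃ = σ⁻¹ makes the word of `V1` trivial and leaves σ z₁ σ z₁⁻¹.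
  · exact .inl (hρ.subst ![Z 0, 1, (ofG σ)⁻¹, 1] (hρ.twist 0) (by simp [mul_assoc]))
  · exact .inl ((hρ.twist 0).conj (Z 2 * ofG σ) (by group))
  · exact .inl (hρ.subst ![Z 0, 1, (ofG σ)⁻¹, 1] (hρ.twist 0) (by simp [mul_assoc]))
  -- Here the product is z₃ σ⁻¹ z₃⁻¹, a conjugate of σ⁻¹, to which neither basic word applies.
  · exact absurd .z_z h₁
  · exact absurd .z_z h₂
  · exact absurd .z_p h₁
  · exact absurd .z_p h₂
  · exact absurd .z_t h₁
  · exact absurd .z_t h₂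
  · exact .inl ((hρ.twist' 0).conj (Z 2) (by group))
  · exact .inl (hρ.subst ![Z 0, 1, 1, 1] (hρ.twist' 0) (by simp [mul_assoc]))
  · right; group
  · exact .inl (hρ.subst ![(ofG σ)⁻¹, 1, Z 2, 1] (hρ.comm 2) (by simp [mul_assoc]))
  · right; group
  · exact .inl (hρ.subst ![(ofG σ)⁻¹, 1, Z 2, 1] (hρ.comm 2) (by simp [mul_assoc]))
  · exact absurd .v_z h₁
  · exact absurd .v_z h₂
  · exact absurd .v_p h₁
  · exact absurd .v_p h₂
  · exact absurd .v_t h₁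
  · exact absurd .v_t h₂
  · right; group
  · exact .inl (hρ.subst ![(ofG σ)⁻¹, Z 1, 1, 1] (hρ.comm' 1) (by simp [mul_assoc, pow_succ']))
  · exact .inl ((hρ.twist' 0).conj (1) (by group))
  · exact .inl (hρ.subst ![Z 0, 1, 1, 1] (hρ.twist' 0) (by simp [mul_assoc]))
  · right; group
  · exact .inl (hρ.subst ![(ofG σ)⁻¹, Z 1, 1, 1] (hρ.comm' 1) (by simp [mul_assoc]))
  · right; group
  · exact .inl (hρ.subst ![(ofG σ)⁻¹, 1, 1, Z 3] (hρ.comm 3) (by simp [mul_assoc]))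
  · exact .inl ((hρ.twist' 0).conj (Z 3) (by group))
  · exact .inl (hρ.subst ![Z 0, 1, 1, 1] (hρ.twist' 0) (by simp [mul_assoc]))
  · right; group
  · exact .inl (hρ.subst ![(ofG σ)⁻¹, 1, 1, Z 3] (hρ.comm 3) (by simp [mul_assoc]))
  · right; group
  · exact .inl (hρ.subst ![(ofG σ)⁻¹, Z 1, 1, 1] (hρ.comm' 1) (by simp [mul_assoc, pow_succ']))

/-- An old element `g`, times a conjugate of `σ`. -/
theorem IsGenericRep.unitWord_mul_conj (hρ : IsGenericRep σ ρ) {g : Monoid.Coprod G (FreeGroup F)}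
    (hg : UnitOrOne ρ (Monoid.Coprod.inl g * ofG σ, 1)) {ω : AugWord G F}
    (hω : UnitWord ρ ((ofG σ)⁻¹ * ω * ofG σ * ω⁻¹)) (z : Fin 4 → AugWord G F)
    (hz : AugWord.subst z (ω * ofG σ * ω⁻¹) = ofG σ) :
    UnitWord ρ (Monoid.Coprod.inl g * (ω * ofG σ * ω⁻¹)) := by
  -- If ρ(gσ) - 1 is invertible, a substitution turns the conjugate of σ into σ itself. If ρ(gσ) =
  -- 1, the product acts as the commutator σ⁻¹ ω σ ω⁻¹.
  rcases hg with hg | hg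
  · exact hρ.subst z hg (by rw [map_mul, hz, subst_inl])
  · have h1 : ((Monoid.Coprod.inl g * (ω * ofG σ * ω⁻¹), 1) :
        AugWord G F × Multiplicative (Fin N → ℤ)) =
        (Monoid.Coprod.inl g * ofG σ, 1) * ((ofG σ)⁻¹ * ω * ofG σ * ω⁻¹, 1) := by
      refine Prod.ext ?_ (one_mul _).symm
      change _ = Monoid.Coprod.inl g * ofG σ * ((ofG σ)⁻¹ * ω * ofG σ * ω⁻¹)
      group
    rw [UnitWord, h1, map_mul, hg, one_mul]
    exact hω

end Words

/-! ### Central parts of the new symbols, and products of three of them. -/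

namespace Scrambling

open AugGen AugSym

variable {S : Type u} {T : Type v} {P : SymTriPres S} {Q : SymTriPres T}
variable (D : Scrambling P Q) (s : S) {r : ℕ} (k : Fin r → Fin D.N) (ε : Fin r → ℤˣ)

/-- The shape of a new symbol. -/
def shape {N r : ℕ} : AugSym N r → AugShape
  | z a => .Z a
  | u a _ => .Z a
  | v1 => .V1
  | v2 => .V2
  | v3 => .V3
  | p l => .P l
  | q l => .P (l + 1)
  | w l => .W (r - l)
  | t => .T

theorem symWord_eq (y : AugSym D.N r) : D.symWord s y = (shape y).word (P.gen s) := by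
  cases y <;> rfl

/-- The central part of a symbol of given shape, up to a central generator. -/
noncomputable def shapeCen : AugShape → Fin D.N → ℤ
  | .Z _ => 0
  | .V1 => D.cen s
  | .V2 => D.cen s
  | .V3 => D.cen s + D.cen s
  | .P i => D.gam s k ε i
  | .W _ => 0
  | .T => 0

/-- Only u_{a,m} and q_l deviate from the central part of their shape, by a signed basis vector. The
deviation is the value of an old generator, so it can be absorbed into the triple axiom, and it is
small compared with the large coefficient of s'. -/
theorem exists_symCen (y : AugSym D.N r) : ∃ (x : T) (δ : Fin D.N → ℤ),
    D.oldHom (Q.gen x) = (1, Multiplicative.ofAdd δ) ∧ (∀ m, |D.b.repr δ m| ≤ 1) ∧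
      D.symCen s k ε y = D.shapeCen s k ε (shape y) + δ := by
  have h0 : ∃ (x : T) (δ : Fin D.N → ℤ), D.oldHom (Q.gen x) = (1, Multiplicative.ofAdd δ) ∧
      (∀ m, |D.b.repr δ m| ≤ 1) ∧ δ = 0 :=
    ⟨Q.e, 0, by rw [SymTriPres.gen_e, map_one]; rfl, by simp, rfl⟩
  have hsingle : ∀ m m' : Fin D.N, |D.b.repr (D.b m) m'| ≤ 1 := by
    intro m m'
    rw [D.b.repr_self, Finsupp.single_apply]
    split_ifs <;> simp
  cases y with
  | u a m => exact ⟨D.j m, D.b m, D.oldHom_j m, hsingle m, by simp [symCen, shapeCen, shape]⟩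
  | q l =>
    -- q_l has the word of p_{l+1} but precedes multiplication by β_{l+1}; hence the sign.
    refine ⟨Q.inv (D.bPow (k l) (ε l)), -((ε l : ℤ) • D.b (k l)), ?_, fun m => ?_, ?_⟩
    · rw [SymTriPres.gen_inv, map_inv, oldHom_bPow]
      refine Prod.ext inv_one rfl
    · rw [map_neg, map_zsmul, Finsupp.neg_apply, abs_neg, Finsupp.smul_apply, smul_eq_mul,
        abs_mul]
      rcases Int.units_eq_one_or (ε l) with h | h <;> rw [h] <;> simpa using hsingle (k l) m
    · simp only [symCen, shapeCen, shape, gam_succ]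
      abel
  | _ =>
    obtain ⟨x, δ, h1, h2, rfl⟩ := h0
    exact ⟨x, 0, h1, h2, by simp [symCen, shapeCen, shape]⟩

theorem symVal_eq (y : AugSym D.N r) : D.symVal s k ε y =
    ((shape y).word (P.gen s), Multiplicative.ofAdd (D.symCen s k ε y)) := by
  rw [symVal, symWord_eq]

theorem abT_oldHom (x : Q.Grp) : abT (D.oldHom x).1 = (ScrTarget.piAb (D.μ x)).1 := by
  simp [oldHom_apply, abT, ScrTarget.piAb, ScrTarget.freeAb]

theorem piAb_eq_iff (x y : Q.Grp) : ScrTarget.piAb (D.μ x) = ScrTarget.piAb (D.μ y) ↔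
    abT (D.oldHom x).1 = abT (D.oldHom y).1 ∧ (D.oldHom x).2 = (D.oldHom y).2 := by
  rw [abT_oldHom, abT_oldHom, Prod.ext_iff]
  rfl

theorem eq_of_oldHom_ab_eq {x y : T}
    (h₁ : abT (D.oldHom (Q.gen x)).1 = abT (D.oldHom (Q.gen y)).1)
    (h₂ : (D.oldHom (Q.gen x)).2 = (D.oldHom (Q.gen y)).2) : x = y := by
  by_contra h
  exact D.piAb_injective x y h ((D.piAb_eq_iff _ _).2 ⟨h₁, h₂⟩)

section Rep

variable {n : ℕ} {L : Type} [Field L]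
  {ρ : AugWord P.Grp P.rel × Multiplicative (Fin D.N → ℤ) →* Matrix.GeneralLinearGroup (Fin n) L}

variable {D s}

theorem unitOrOne_oldHom (hρ : IsGenericRep (P.gen s) ρ) (x y z : T) :
    UnitOrOne ρ (D.oldHom (Q.gen x * Q.gen y * Q.gen z)) := by
  rcases D.triple z y x with h | h | h
  · rw [Ne, ← map_one ScrTarget.piAb, ← map_one D.μ, piAb_eq_iff] at h
    rw [map_one D.oldHom, Prod.fst_one, map_one, Prod.snd_one, not_and_or] at h
    exact .inl (h.elim (hρ.unit_of_abT _) (hρ.unit_of_snd _))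
  · right
    rw [h, map_one, map_one]
  · by_cases h2 : (D.oldHom (Q.gen x * Q.gen y * Q.gen z)).2 = 1
    · have h3 := hρ.unit_or_of_sufficientlyGeneric _ h
      rw [← h2] at h3
      exact h3
    · exact .inl (hρ.unit_of_snd _ h2)

/-- Any nontrivial abelian invariant already gives invertibility, so all three may be assumed
trivial. -/
theorem unitOrOne_of_ab (hρ : IsGenericRep (P.gen s) ρ) {w}
    (h : abT w.1 = 1 → abZ w.1 = 1 → w.2 = 1 → UnitOrOne ρ w) : UnitOrOne ρ w := by
  by_cases h1 : abT w.1 = 1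
  · by_cases h2 : abZ w.1 = 1
    · by_cases h3 : w.2 = 1
      · exact h h1 h2 h3
      · exact .inl (hρ.unit_of_snd _ h3)
    · exact .inl (hρ.unit_of_abZ _ h2)
  · exact .inl (hρ.unit_of_abT _ h1)

variable {k ε}

/-- Products of three new symbols. -/
theorem unitOrOne_pos_pos_neg (hρ : IsGenericRep (P.gen s) ρ) (x y z : AugSym D.N r) :
    UnitOrOne ρ (D.symVal s k ε x * D.symVal s k ε y * (D.symVal s k ε z)⁻¹) := by
  refine unitOrOne_of_ab hρ fun _ h1 h2 => ?_
  simp only [symVal_eq, Prod.fst_mul, Prod.fst_inv, map_mul, map_inv, AugShape.abZ_word,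
    ← ofAdd_add, ← ofAdd_neg, Prod.snd_mul, Prod.snd_inv, ofAdd_eq_one] at h1 h2
  have hdeg : (shape x).deg + (shape y).deg = (shape z).deg := by
    rw [← sub_eq_zero, sub_eq_add_neg]; exact h1
  obtain ⟨κ, h5, -⟩ := D.large_coeff s
  change 5 ≤ D.b.repr (D.cen s) κ at h5
  -- In a bad triple the shapes contribute ±π_ℤ(s') to the central part, and the three deviations
  -- change the large coefficient, at least 5, by at most 3.
  have hbad : ∀ x y : AugSym D.N r,
      D.symCen s k ε x + D.symCen s k ε y + -D.symCen s k ε z = 0 →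
      ¬ BadTriple (shape x) (shape y) (shape z) := by
    intro x y h hb
    obtain ⟨-, δ₁, -, b1, e1⟩ := D.exists_symCen s k ε x
    obtain ⟨-, δ₂, -, b2, e2⟩ := D.exists_symCen s k ε y
    obtain ⟨-, δ₃, -, b3, e3⟩ := D.exists_symCen s k ε z
    have b1 := abs_le.1 (b1 κ)
    have b2 := abs_le.1 (b2 κ)
    have b3 := abs_le.1 (b3 κ)
    have h := congrArg (fun v => D.b.repr v κ) h
    rw [e1, e2, e3] at h
    generalize shape x = X at *
    generalize shape y = Y at *
    generalize shape z = Z at *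
    cases hb <;> simp [shapeCen, gam_zero] at h <;> omega
  have hword := hρ.unitOrOne_word hdeg (hbad x y h2) (hbad y x (by rw [← h2]; abel))
  have heq : D.symVal s k ε x * D.symVal s k ε y * (D.symVal s k ε z)⁻¹ =
      ((shape x).word (P.gen s) * (shape y).word (P.gen s) * ((shape z).word (P.gen s))⁻¹, 1) := by
    rw [symVal_eq, symVal_eq, symVal_eq]
    refine Prod.ext rfl ?_
    exact h2
  rw [heq]
  refine hword.imp id fun h => ?_
  rw [h]
  exact map_one ρ

end Rep

end Scrambling

/-! ### Products of one old generator and two new symbols; all products of three generators. -/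

namespace Scrambling

open AugGen AugSym

variable {S : Type u} {T : Type v} {P : SymTriPres S} {Q : SymTriPres T}
variable {D : Scrambling P Q} {s : S} {r : ℕ} {k : Fin r → Fin D.N} {ε : Fin r → ℤˣ}
variable {n : ℕ} {L : Type} [Field L]
  {ρ : AugWord P.Grp P.rel × Multiplicative (Fin D.N → ℤ) →* Matrix.GeneralLinearGroup (Fin n) L}

theorem unitOrOne_of_unitWord {w} {w' : AugWord P.Grp P.rel} (h : UnitWord ρ w')
    (h₁ : w.1 = w') (h₂ : w.2 = 1) : UnitOrOne ρ w := by
  obtain ⟨a, b⟩ := w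
  obtain rfl : a = w' := h₁
  obtain rfl : b = 1 := h₂
  exact .inl h

theorem eq_v1_of_shape {y : AugSym D.N r} (h : shape y = .V1) : y = v1 := by
  cases y <;> simp [shape] at h ⊢

theorem eq_v2_of_shape {y : AugSym D.N r} (h : shape y = .V2) : y = v2 := by
  cases y <;> simp [shape] at h ⊢

theorem eq_v3_of_shape {y : AugSym D.N r} (h : shape y = .V3) : y = v3 := by
  cases y <;> simp [shape] at h ⊢

theorem eq_t_of_shape {y : AugSym D.N r} (h : shape y = .T) : y = t := by
  cases y <;> simp [shape] at h ⊢

variable (D s k ε) in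
theorem exists_symVal_eq_of_shape_z {y : AugSym D.N r} {a : Fin 4} (h : shape y = .Z a) :
    ∃ (x : T) (δ : Fin D.N → ℤ), D.oldHom (Q.gen x) = (1, Multiplicative.ofAdd δ) ∧
      (∀ m, |D.b.repr δ m| ≤ 1) ∧ D.symVal s k ε y = (Z a, Multiplicative.ofAdd δ) := by
  obtain ⟨x, δ, hx, hδ, e⟩ := D.exists_symCen s k ε y
  refine ⟨x, δ, hx, hδ, ?_⟩
  rw [symVal_eq, e, h, shapeCen, zero_add]
  rfl

/-- The products `x y y'⁻¹` and `x y⁻¹ y'`, for old `x`, are mapped to matrices that are the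
identity or have no eigenvalue `1`. -/
def PairUnitOrOne (ρ : AugWord P.Grp P.rel × Multiplicative (Fin D.N → ℤ) →*
    Matrix.GeneralLinearGroup (Fin n) L)
    (a b : AugWord P.Grp P.rel × Multiplicative (Fin D.N → ℤ)) : Prop :=
  ∀ x : T, UnitOrOne ρ (D.oldHom (Q.gen x) * a * b⁻¹) ∧
    UnitOrOne ρ (D.oldHom (Q.gen x) * a⁻¹ * b)

theorem PairUnitOrOne.symm {a b} (h : PairUnitOrOne ρ a b) : PairUnitOrOne ρ b a := by
  intro x
  obtain ⟨h1, h2⟩ := h (Q.inv x)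
  rw [SymTriPres.gen_inv, map_inv, mul_assoc] at h1 h2
  have h1 := h1.cyc.inv
  have h2 := h2.cyc.inv
  constructor
  · convert h1 using 1
    group
  · convert h2 using 1
    group

/-- The words cancel and the central deviations are old generators, so only products of three old
generators remain. -/
theorem pairUnitOrOne_of_shape_eq (hρ : IsGenericRep (P.gen s) ρ) {y y' : AugSym D.N r}
    (h : shape y = shape y') : PairUnitOrOne ρ (D.symVal s k ε y) (D.symVal s k ε y') := by
  intro x
  obtain ⟨j, δ, hj, -, e⟩ := D.exists_symCen s k ε y
  obtain ⟨j', δ', hj', -, e'⟩ := D.exists_symCen s k ε y'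
  constructor
  · convert unitOrOne_oldHom hρ x j (Q.inv j') using 1
    rw [SymTriPres.gen_inv, map_mul, map_mul, map_inv, hj, hj', symVal_eq, symVal_eq, e, e', h]
    refine Prod.ext (by simp) (Multiplicative.toAdd.injective ?_)
    simp only [Prod.snd_mul, Prod.snd_inv, toAdd_mul, toAdd_inv, toAdd_ofAdd]
    abel
  · convert unitOrOne_oldHom hρ x (Q.inv j) j' using 1
    rw [SymTriPres.gen_inv, map_mul, map_mul, map_inv, hj, hj', symVal_eq, symVal_eq, e, e', h]
    refine Prod.ext (by simp) (Multiplicative.toAdd.injective ?_)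
    simp only [Prod.snd_mul, Prod.snd_inv, toAdd_mul, toAdd_inv, toAdd_ofAdd]
    abel

/-- In one order the word is an old element times z₃ s z₃⁻¹, the case of `unitWord_mul_conj`. In the
other z₃ cancels and three old generators are left. -/
theorem pairUnitOrOne_v1 (hρ : IsGenericRep (P.gen s) ρ) {y' : AugSym D.N r}
    (h : shape y' = .Z 2) : PairUnitOrOne ρ (D.symVal s k ε v1) (D.symVal s k ε y') := by
  intro x
  obtain ⟨j, δ, hj, -, e⟩ := D.exists_symVal_eq_of_shape_z s k ε h
  have hv : D.symVal s k ε v1 = (Z 2 * ofG (P.gen s), Multiplicative.ofAdd (D.cen s)) := rfl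
  constructor
  · refine unitOrOne_of_ab hρ fun _ _ h2 => ?_
    have h3 := unitOrOne_oldHom hρ x (D.i s) (Q.inv j)
    rw [SymTriPres.gen_inv, map_mul, map_mul, map_inv, hj, oldHom_i] at h3
    rw [e, hv] at h2 ⊢
    have h4 : UnitOrOne ρ (Monoid.Coprod.inl (D.μ (Q.gen x)).1 * ofG (P.gen s), 1) := by
      convert h3 using 1
      refine Prod.ext (by simp [oldHom_apply]) h2.symm
    have h5 := hρ.unitWord_mul_conj h4 (ω := Z 2)
      ((hρ.comm' 2).conj (ofG (P.gen s))⁻¹ (by group)) ![1, 1, 1, 1] (by simp)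
    exact unitOrOne_of_unitWord h5 (by simp [oldHom_apply, mul_assoc]) h2
  · convert unitOrOne_oldHom hρ x (Q.inv (D.i s)) j using 1
    rw [SymTriPres.gen_inv, map_mul, map_mul, map_inv, hj, oldHom_i, e, hv]
    exact Prod.ext (by simp [mul_assoc]) (by simp)

/-- The same dichotomy as for v₁ and z₃, with conjugator z₃ s z₁ in place of z₃. Setting z₃ = s⁻¹
reduces this conjugator to z₁. -/
theorem pairUnitOrOne_v3_v2 (hρ : IsGenericRep (P.gen s) ρ) :
    PairUnitOrOne ρ (D.symVal s k ε v3) (D.symVal s k ε v2) := by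
  intro x
  have hv2 : D.symVal s k ε v2 =
    (Z 2 * ofG (P.gen s) * Z 0, Multiplicative.ofAdd (D.cen s)) := rfl
  have hv3 : D.symVal s k ε v3 = (Z 2 * ofG (P.gen s) * Z 0 * ofG (P.gen s),
    Multiplicative.ofAdd (D.cen s + D.cen s)) := rfl
  constructor
  · refine unitOrOne_of_ab hρ fun _ _ h2 => ?_
    have h3 := unitOrOne_oldHom hρ x (D.i s) Q.e
    rw [SymTriPres.gen_e, mul_one, map_mul, oldHom_i] at h3
    rw [hv2, hv3] at h2 ⊢
    have h4 : UnitOrOne ρ (Monoid.Coprod.inl (D.μ (Q.gen x)).1 * ofG (P.gen s), 1) := by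
      convert h3 using 1
      refine Prod.ext (by simp [oldHom_apply]) ?_
      rw [← h2]
      refine Multiplicative.toAdd.injective ?_
      simp only [Prod.snd_mul, Prod.snd_inv, toAdd_mul, toAdd_inv, toAdd_ofAdd]
      abel
    have h6 : UnitWord ρ ((ofG (P.gen s))⁻¹ * (Z 2 * ofG (P.gen s) * Z 0) * ofG (P.gen s) *
        (Z 2 * ofG (P.gen s) * Z 0)⁻¹) :=
      hρ.subst ![Z 0, 1, (ofG (P.gen s))⁻¹, 1]
        ((hρ.comm' 0).conj (ofG (P.gen s))⁻¹ rfl) (by simp [mul_assoc])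
    have h5 := hρ.unitWord_mul_conj h4 h6 ![1, 1, (ofG (P.gen s))⁻¹, 1] (by simp)
    exact unitOrOne_of_unitWord h5 (by simp [oldHom_apply, mul_assoc]) h2
  · convert unitOrOne_oldHom hρ x (Q.inv (D.i s)) Q.e using 1
    rw [SymTriPres.gen_inv, SymTriPres.gen_e, mul_one, map_mul, map_inv, oldHom_i, hv2, hv3]
    refine Prod.ext (by simp [mul_assoc]) (Multiplicative.toAdd.injective ?_)
    simp only [Prod.snd_mul, Prod.snd_inv, toAdd_mul, toAdd_inv, toAdd_ofAdd]
    abel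

/-- These products have nonzero central part, since the coefficients of the generators are small
at a place where that of `s'` is large. -/
theorem pairUnitOrOne_p_zero (hρ : IsGenericRep (P.gen s) ρ) {y y' : AugSym D.N r}
    (h : shape y = .P 0) (h' : shape y' = .T ∨ ∃ a, shape y' = .Z a) :
    PairUnitOrOne ρ (D.symVal s k ε y) (D.symVal s k ε y') := by
  intro x
  -- With c the large coefficient, the two new symbols contribute at least 2c - 2 in absolute value
  -- and x at most c + 1. The difference c - 3 is positive.
  obtain ⟨κ, h5, hle⟩ := D.large_coeff s
  change 5 ≤ D.b.repr (D.cen s) κ at h5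
  have hx := abs_le.1 (hle x)
  change _ ≤ _ ∧ _ ≤ D.b.repr (D.cen s) κ + 1 at hx
  change -(D.b.repr (D.cen s) κ + 1) ≤ _ ∧ _ at hx
  obtain ⟨-, δ, -, b, e⟩ := D.exists_symCen s k ε y
  obtain ⟨-, δ', -, b', e'⟩ := D.exists_symCen s k ε y'
  have b := abs_le.1 (b κ)
  have b' := abs_le.1 (b' κ)
  have hc : D.shapeCen s k ε (shape y') = 0 := by
    rcases h' with h' | ⟨a, h'⟩ <;> rw [h'] <;> rfl
  rw [h, shapeCen, gam_zero] at e
  rw [hc, zero_add] at e'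
  have hX : (D.oldHom (Q.gen x)).2.toAdd = ScrTarget.piZ (D.μ (Q.gen x)) := rfl
  constructor
  · refine unitOrOne_of_ab hρ fun _ _ h2 => ?_
    rw [symVal_eq, symVal_eq, e, e'] at h2
    have h3 := congrArg (fun v => D.b.repr v.toAdd κ) h2
    simp [hX] at h3
    omega
  · refine unitOrOne_of_ab hρ fun _ _ h2 => ?_
    rw [symVal_eq, symVal_eq, e, e'] at h2
    have h3 := congrArg (fun v => D.b.repr v.toAdd κ) h2
    simp [hX] at h3
    omega

/-- If the abelian invariants vanish, x has those of a purely central generator or of its inverse.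
By injectivity on generators it equals that one, and the bare word s z₁ s z₁⁻¹, up to inversion and
conjugation, remains. -/
theorem pairUnitOrOne_t (hρ : IsGenericRep (P.gen s) ρ) {y' : AugSym D.N r}
    (h : shape y' = .Z 0) : PairUnitOrOne ρ (D.symVal s k ε t) (D.symVal s k ε y') := by
  intro x
  obtain ⟨j, δ, hj, -, e⟩ := D.exists_symVal_eq_of_shape_z s k ε h
  have hv : D.symVal s k ε t = (ofG (P.gen s) * Z 0 * ofG (P.gen s), 1) := rfl
  constructor
  · refine unitOrOne_of_ab hρ fun h1 _ h2 => ?_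
    rw [e, hv] at h1 h2 ⊢
    have hxj : x = j := by
      apply D.eq_of_oldHom_ab_eq
      · rw [hj, map_one]
        simpa using h1
      · rw [hj]
        refine mul_inv_eq_one.1 ?_
        simpa using h2
    exact unitOrOne_of_unitWord (hρ.twist 0) (by simp [hxj, hj]) h2
  · refine unitOrOne_of_ab hρ fun h1 _ h2 => ?_
    rw [e, hv] at h1 h2 ⊢
    have hxj : x = Q.inv j := by
      apply D.eq_of_oldHom_ab_eq
      · rw [SymTriPres.gen_inv, map_inv, hj, Prod.fst_inv, inv_one, map_one]
        simpa using h1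
      · rw [SymTriPres.gen_inv, map_inv, hj]
        refine mul_eq_one_iff_eq_inv.1 ?_
        simpa using h2
    exact unitOrOne_of_unitWord (((hρ.twist 0).conj (Z 0)⁻¹ rfl).inv rfl)
      (by simp [hxj, SymTriPres.gen_inv, hj, mul_assoc]) h2

theorem pairUnitOrOne (hρ : IsGenericRep (P.gen s) ρ) (y y' : AugSym D.N r) :
    PairUnitOrOne ρ (D.symVal s k ε y) (D.symVal s k ε y') := by
  by_cases hdeg : (shape y).deg = (shape y').deg
  · rcases AugShape.eq_of_deg_eq hdeg with h | h | h | h | h | h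
    · exact pairUnitOrOne_of_shape_eq hρ h
    · rcases h with ⟨h, h'⟩ | ⟨h, h'⟩
      · rw [eq_v1_of_shape h]
        exact pairUnitOrOne_v1 hρ h'
      · rw [eq_v1_of_shape h]
        exact (pairUnitOrOne_v1 hρ h').symm
    · rcases h with ⟨h, h'⟩ | ⟨h, h'⟩
      · rw [eq_v3_of_shape h, eq_v2_of_shape h']
        exact pairUnitOrOne_v3_v2 hρ
      · rw [eq_v3_of_shape h, eq_v2_of_shape h']
        exact (pairUnitOrOne_v3_v2 hρ).symm
    · rcases h with ⟨h, h'⟩ | ⟨h, h'⟩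
      · exact pairUnitOrOne_p_zero hρ h (.inl h')
      · exact (pairUnitOrOne_p_zero hρ h (.inl h')).symm
    · rcases h with ⟨h, h'⟩ | ⟨h, h'⟩
      · exact pairUnitOrOne_p_zero hρ h (.inr ⟨_, h'⟩)
      · exact (pairUnitOrOne_p_zero hρ h (.inr ⟨_, h'⟩)).symm
    · rcases h with ⟨h, h'⟩ | ⟨h, h'⟩
      · rw [eq_t_of_shape h]
        exact pairUnitOrOne_t hρ h'
      · rw [eq_t_of_shape h]
        exact (pairUnitOrOne_t hρ h').symm
  · have hX : ∀ x : T, abZ (D.oldHom (Q.gen x)).1 = 1 := fun x => by simp [oldHom_apply]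
    intro x
    constructor <;> refine unitOrOne_of_ab hρ fun _ h1 _ => absurd ?_ hdeg
    · simpa [symVal_eq, hX, AugShape.abZ_word, mul_inv_eq_one] using h1
    · simpa [symVal_eq, hX, AugShape.abZ_word, inv_mul_eq_one] using h1

/-- The total exponent of the letters `z_a`. -/
def zWeight (w : AugWord P.Grp P.rel × Multiplicative (Fin D.N → ℤ)) : ℤ :=
  ∑ a, (abZ w.1).toAdd a

theorem zWeight_mul (a b : AugWord P.Grp P.rel × Multiplicative (Fin D.N → ℤ)) :
    zWeight (a * b) = zWeight a + zWeight b := by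
  simp [zWeight, Finset.sum_add_distrib]

theorem zWeight_inv (a : AugWord P.Grp P.rel × Multiplicative (Fin D.N → ℤ)) :
    zWeight a⁻¹ = -zWeight a := by
  simp [zWeight]

theorem zWeight_symVal_pos (y : AugSym D.N r) : 0 < zWeight (D.symVal s k ε y) := by
  rw [zWeight, symVal_eq, AugShape.abZ_word]
  exact AugShape.deg_sum_pos _

theorem zWeight_oldHom (x : T) : zWeight (D.oldHom (Q.gen x)) = 0 := by
  simp [zWeight, oldHom_apply]

theorem unitSubOne_of_zWeight (hρ : IsGenericRep (P.gen s) ρ) {w} (hw : zWeight w ≠ 0) :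
    UnitSubOne (ρ w) := by
  refine hρ.unit_of_abZ w fun h => hw ?_
  rw [zWeight, h]
  simp

theorem _root_.UnitOrOne.cyc₃ {a b c : AugWord P.Grp P.rel × Multiplicative (Fin D.N → ℤ)}
    (h : UnitOrOne ρ (a * b * c)) : UnitOrOne ρ (b * c * a) := by
  rw [mul_assoc] at h
  exact h.cyc

theorem unitOrOne_pos_neg_neg (hρ : IsGenericRep (P.gen s) ρ) (x y z : AugSym D.N r) :
    UnitOrOne ρ (D.symVal s k ε x * (D.symVal s k ε y)⁻¹ * (D.symVal s k ε z)⁻¹) := by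
  convert (unitOrOne_pos_pos_neg (k := k) (ε := ε) hρ z y x).inv using 1
  group

/-- Products of three generators of the augmentation. -/
theorem unitOrOne_augVal (hρ : IsGenericRep (P.gen s) ρ) (x y z : AugGen T D.N r) :
    UnitOrOne ρ (D.augVal s k ε x * D.augVal s k ε y * D.augVal s k ε z) := by
  have hp := fun y y' => pairUnitOrOne (k := k) (ε := ε) hρ y y'
  have hppn := unitOrOne_pos_pos_neg (k := k) (ε := ε) hρ
  have hpnn := unitOrOne_pos_neg_neg (k := k) (ε := ε) hρ
  have hpos := zWeight_symVal_pos (D := D) (s := s) (k := k) (ε := ε)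
  rcases x with x | x | x <;> rcases y with y | y | y <;> rcases z with z | z | z <;>
    simp only [augVal]
  case old.old.old =>
    rw [← map_mul, ← map_mul]
    exact unitOrOne_oldHom hρ x y z
  case old.pos.neg => exact (hp y z x).1
  case old.neg.pos => exact (hp y z x).2
  case pos.neg.old => exact UnitOrOne.cyc₃ (hp x y z).1
  case neg.pos.old => exact UnitOrOne.cyc₃ (hp x y z).2
  case neg.old.pos => exact UnitOrOne.cyc₃ (UnitOrOne.cyc₃ (hp z x y).1)
  case pos.old.neg => exact UnitOrOne.cyc₃ (UnitOrOne.cyc₃ (hp z x y).2)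
  case pos.pos.neg => exact hppn x y z
  case pos.neg.pos => exact UnitOrOne.cyc₃ (hppn z x y)
  case neg.pos.pos => exact UnitOrOne.cyc₃ (UnitOrOne.cyc₃ (hppn y z x))
  case pos.neg.neg => exact hpnn x y z
  case neg.neg.pos => exact UnitOrOne.cyc₃ (hpnn z x y)
  case neg.pos.neg => exact UnitOrOne.cyc₃ (UnitOrOne.cyc₃ (hpnn y z x))
  -- In the remaining sign patterns the total exponent of the z_a cannot vanish.
  all_goals
    refine .inl (unitSubOne_of_zWeight hρ ?_)
    simp only [zWeight_mul, zWeight_inv, zWeight_oldHom]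
    first | have := hpos x | skip
    first | have := hpos y | skip
    first | have := hpos z | skip
    omega

end Scrambling

/-! ### Invertible differences of distinct generators. -/

namespace Scrambling

open AugGen AugSym

variable {S : Type u} {T : Type v} {P : SymTriPres S} {Q : SymTriPres T}
variable {D : Scrambling P Q} {s : S} {r : ℕ} {k : Fin r → Fin D.N} {ε : Fin r → ℤˣ}
variable {n : ℕ} {L : Type} [Field L]
  {ρ : AugWord P.Grp P.rel × Multiplicative (Fin D.N → ℤ) →* Matrix.GeneralLinearGroup (Fin n) L}

/-- Symbols sharing a shape are z_a and the u_{a,m}, or p_{l+1} and q_l. Linear independence of the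
basis separates their central parts. -/
theorem eq_of_shape_eq_of_symCen_eq {y y' : AugSym D.N r} (h : shape y = shape y')
    (hc : D.symCen s k ε y = D.symCen s k ε y') : y = y' := by
  have hq : ∀ l : Fin r, D.gam s k ε (l + 1) ≠ D.gam s k ε l := fun l h => by
    rw [gam_succ, add_eq_left] at h
    rcases Int.units_eq_one_or (ε l) with he | he <;> rw [he] at h <;>
      exact D.b.ne_zero (k l) (by simpa using h)
  cases y <;> cases y' <;> simp only [shape, AugShape.Z.injEq, AugShape.P.injEq,
    AugShape.W.injEq, reduceCtorEq] at h
  case z.z => rw [h]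
  case z.u => exact absurd hc.symm (D.b.ne_zero _)
  case u.z => exact absurd hc (D.b.ne_zero _)
  case u.u => rw [h, D.b.injective hc]
  case p.p => rw [Fin.ext h]
  case p.q l l' =>
    simp only [symCen, h] at hc
    exact absurd hc (hq l')
  case q.p l l' =>
    simp only [symCen, ← h] at hc
    exact absurd hc.symm (hq l)
  case q.q => rw [Fin.ext (Nat.succ_injective h)]
  case w.w l l' => rw [Fin.ext (by omega : l.val = l'.val)]
  all_goals rfl

/-- The other coincidences of exponents involve central parts differing by one or two times π_ℤ(s'),
too much for two deviations. Only t against z₁ survives, and there the twisted commutator decides.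
-/
theorem symbol_separation {y y' : AugSym D.N r} (h : (shape y).deg = (shape y').deg)
    (hc : D.symCen s k ε y = D.symCen s k ε y') :
    y = y' ∨ (shape y = .T ∧ shape y' = .Z 0 ∨ shape y' = .T ∧ shape y = .Z 0) := by
  obtain ⟨κ, h5, -⟩ := D.large_coeff s
  change 5 ≤ D.b.repr (D.cen s) κ at h5
  obtain ⟨-, δ, -, b, e⟩ := D.exists_symCen s k ε y
  obtain ⟨-, δ', -, b', e'⟩ := D.exists_symCen s k ε y'
  have b := abs_le.1 (b κ)
  have b' := abs_le.1 (b' κ)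
  rcases AugShape.eq_of_deg_eq h with h | h | h | h | h | h
  · exact .inl (eq_of_shape_eq_of_symCen_eq h hc)
  on_goal 5 => exact .inr h
  all_goals
    exfalso
    rw [e, e'] at hc
    have hc := congrArg (fun v => D.b.repr v κ) hc
    rcases h with ⟨h, h'⟩ | ⟨h, h'⟩ <;> simp [h, h', shapeCen, gam_zero] at hc <;> omega

theorem unitSubOne_symVal (hρ : IsGenericRep (P.gen s) ρ) {y y' : AugSym D.N r} (h : y ≠ y') :
    UnitSubOne (ρ (D.symVal s k ε y * (D.symVal s k ε y')⁻¹)) := by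
  by_cases hd : (shape y).deg = (shape y').deg
  · by_cases hc : D.symCen s k ε y = D.symCen s k ε y'
    · have hval : D.symVal s k ε y * (D.symVal s k ε y')⁻¹ =
          ((shape y).word (P.gen s) * ((shape y').word (P.gen s))⁻¹, 1) := by
        rw [symVal_eq, symVal_eq, hc]
        exact Prod.ext rfl (mul_inv_cancel _)
      rw [hval]
      change UnitWord ρ _
      rcases (symbol_separation hd hc).resolve_left h with ⟨h, h'⟩ | ⟨h, h'⟩
      · rw [h, h']
        exact hρ.twist 0
      · rw [h, h']
        exact (hρ.twist 0).inv (by simp [AugShape.word, mul_assoc])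
    · refine hρ.unit_of_snd _ fun h => hc ?_
      exact Multiplicative.ofAdd.injective (mul_inv_eq_one.1 h)
  · refine hρ.unit_of_abZ _ fun h => hd ?_
    simpa [symVal_eq, AugShape.abZ_word, mul_inv_eq_one] using h

theorem unitSubOne_augVal (hρ : IsGenericRep (P.gen s) ρ) {x y : AugGen T D.N r} (h : x ≠ y) :
    UnitSubOne (ρ (D.augVal s k ε x * (D.augVal s k ε y)⁻¹)) := by
  have hpos := zWeight_symVal_pos (D := D) (s := s) (k := k) (ε := ε)
  rcases x with x | x | x <;> rcases y with y | y | y <;> simp only [augVal]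
  case old.old =>
    have hxy : x ≠ y := fun e => h (by rw [e])
    by_cases h1 : abT (D.oldHom (Q.gen x)).1 = abT (D.oldHom (Q.gen y)).1
    · refine hρ.unit_of_snd _ fun h2 => hxy (D.eq_of_oldHom_ab_eq h1 (mul_inv_eq_one.1 h2))
    · refine hρ.unit_of_abT _ fun h2 => h1 ?_
      rwa [Prod.fst_mul, Prod.fst_inv, map_mul, map_inv, mul_inv_eq_one] at h2
  case pos.pos => exact unitSubOne_symVal hρ fun e => h (by rw [e])
  case neg.neg =>
    have h1 := (unitSubOne_symVal (k := k) (ε := ε) hρ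
      (y := y) (y' := x) fun e => h (by rw [e])).conj (ρ (D.symVal s k ε x))⁻¹
    convert h1 using 1
    rw [← map_inv, ← map_mul, ← map_inv, ← map_mul]
    congr 1
    group
  all_goals
    refine unitSubOne_of_zWeight hρ ?_
    simp only [zWeight_mul, zWeight_inv, zWeight_oldHom]
    first | have := hpos x | skip
    first | have := hpos y | skip
    omega

end Scrambling

namespace Scrambling

open AugGen AugSym

variable {S : Type u} {T : Type v} {P : SymTriPres S} {Q : SymTriPres T}
variable (D : Scrambling P Q) (s : S) {r : ℕ} (k : Fin r → Fin D.N) (ε : Fin r → ℤˣ)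

/-! ### The augmentation contains `G` -/

theorem gen_mul_eq_of_augRel {a b c : AugGen T D.N r} (h : AugRel D s k ε a b (c.inv Q.inv)) :
    (D.augmentation s k ε).gen a * (D.augmentation s k ε).gen b =
      (D.augmentation s k ε).gen c := by
  have h1 := SymTriPres.gen_mul_gen_mul_gen (P := D.augmentation s k ε) (AugRelSym.base h)
  have h2 : (D.augmentation s k ε).gen (c.inv Q.inv) = ((D.augmentation s k ε).gen c)⁻¹ :=
    SymTriPres.gen_inv (P := D.augmentation s k ε) c
  exact mul_inv_eq_one.1 ((congrArg
    ((D.augmentation s k ε).gen a * (D.augmentation s k ε).gen b * ·) h2).symm.trans h1)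

theorem gen_neg (y : AugSym D.N r) :
    (D.augmentation s k ε).gen (neg y) = ((D.augmentation s k ε).gen (pos y))⁻¹ :=
  SymTriPres.gen_inv (P := D.augmentation s k ε) (pos y)

/-- The homomorphism from `G'` to the augmentation. -/
def oldIncl : Q.Grp →* (D.augmentation s k ε).Grp :=
  SymTriPres.lift (fun x => (D.augmentation s k ε).gen (old x))
    (SymTriPres.gen_e (D.augmentation s k ε)) fun _ _ _ h =>
      SymTriPres.gen_mul_gen_mul_gen (P := D.augmentation s k ε)
        (AugRelSym.base (AugRel.old_rel h))

theorem oldIncl_gen (x : T) :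
    D.oldIncl s k ε (Q.gen x) = (D.augmentation s k ε).gen (old x) :=
  SymTriPres.lift_gen _ _ _ _

/-- The homomorphism from `G` to the augmentation. -/
def baseIncl : P.Grp →* (D.augmentation s k ε).Grp :=
  (D.oldIncl s k ε).comp (D.μ.symm.toMonoidHom.comp
    ((MonoidHom.inl _ _).comp Monoid.Coprod.inl))

/-- The homomorphism from `ℤ^N` to the augmentation. -/
def cenIncl : Multiplicative (Fin D.N → ℤ) →* (D.augmentation s k ε).Grp :=
  (D.oldIncl s k ε).comp (D.μ.symm.toMonoidHom.comp (MonoidHom.inr _ _))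

theorem gen_old_i : (D.augmentation s k ε).gen (old (D.i s)) =
    D.baseIncl s k ε (P.gen s) * D.cenIncl s k ε (Multiplicative.ofAdd (D.cen s)) := by
  rw [← oldIncl_gen]
  change _ = D.oldIncl s k ε (D.μ.symm (Monoid.Coprod.inl (P.gen s), 1)) *
    D.oldIncl s k ε (D.μ.symm (1, Multiplicative.ofAdd (D.cen s)))
  rw [← map_mul, ← map_mul]
  congr 1
  rw [MulEquiv.eq_symm_apply, μ_i_eq]
  simp

theorem gen_old_of_μ {x : T} {v : Fin D.N → ℤ}
    (h : D.μ (Q.gen x) = (1, Multiplicative.ofAdd v)) :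
    (D.augmentation s k ε).gen (old x) = D.cenIncl s k ε (Multiplicative.ofAdd v) := by
  rw [← oldIncl_gen, cenIncl, MonoidHom.comp_apply]
  congr 1
  apply D.μ.injective
  rw [h]
  simp

theorem μ_bPow (m : Fin D.N) (e : ℤˣ) :
    D.μ (Q.gen (D.bPow m e)) = (1, Multiplicative.ofAdd ((e : ℤ) • D.b m)) := by
  rcases Int.units_eq_one_or e with rfl | rfl
  · simp [bPow, D.μ_j]
  · simp [bPow, SymTriPres.gen_inv, D.μ_j]

theorem commute_cenIncl_baseIncl (x : Multiplicative (Fin D.N → ℤ)) (g : P.Grp) :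
    Commute (D.cenIncl s k ε x) (D.baseIncl s k ε g) := by
  refine Commute.map (Commute.map ?_ D.μ.symm.toMonoidHom) (D.oldIncl s k ε)
  exact Prod.ext (by simp) (by simp)

/-- The two relators for u_{a,m} say u = b_m z_a and u b_m⁻¹ = z_a. So z_a commutes with each basis
element, hence with their span. -/
theorem commute_cenIncl_z (x : Multiplicative (Fin D.N → ℤ)) (a : Fin 4) :
    Commute (D.cenIncl s k ε x) ((D.augmentation s k ε).gen (pos (z a))) := by
  have hx : x.toAdd ∈ Submodule.span ℤ (Set.range D.b) := by
    rw [D.b.span_eq]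
    trivial
  change Commute (D.cenIncl s k ε (Multiplicative.ofAdd x.toAdd)) _
  generalize x.toAdd = v at hx ⊢
  induction hx using Submodule.span_induction with
  | mem v hv =>
    obtain ⟨m, rfl⟩ := hv
    rw [← D.gen_old_of_μ s k ε (D.μ_j m)]
    have h1 := D.gen_mul_eq_of_augRel s k ε (c := pos (u a m)) (AugRel.u_def a m)
    have h2 := D.gen_mul_eq_of_augRel s k ε (c := pos (z a)) (AugRel.u_comm a m)
    have h3 : (D.augmentation s k ε).gen (old (Q.inv (D.j m))) =
        ((D.augmentation s k ε).gen (old (D.j m)))⁻¹ :=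
      SymTriPres.gen_inv (P := D.augmentation s k ε) (old (D.j m))
    rw [h3, ← h1, mul_inv_eq_iff_eq_mul] at h2
    exact h2
  | zero =>
    rw [ofAdd_zero, map_one]
    exact Commute.one_left _
  | add v w _ _ hv hw =>
    rw [ofAdd_add, map_mul]
    exact hv.mul_left hw
  | smul c v _ hv =>
    rw [ofAdd_zsmul, map_zpow]
    exact hv.zpow_left c

/-- The defining relators are unwound and the central factors moved to the right past s, z₁ and z₂.
-/
theorem gen_p (l : Fin (r + 1)) : (D.augmentation s k ε).gen (pos (p l)) =
    D.baseIncl s k ε (P.gen s) * (D.augmentation s k ε).gen (pos (z 0)) *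
      D.baseIncl s k ε (P.gen s) * (D.augmentation s k ε).gen (pos (z 1)) ^ l.val *
      D.cenIncl s k ε (Multiplicative.ofAdd (D.gam s k ε l)) := by
  induction l using Fin.induction with
  | zero =>
    have h1 := D.gen_mul_eq_of_augRel s k ε (c := pos v1) AugRel.v1_def
    have h2 := D.gen_mul_eq_of_augRel s k ε (c := pos v2) AugRel.v2_def
    have h3 := D.gen_mul_eq_of_augRel s k ε (c := pos v3) AugRel.v3_def
    have h4 := D.gen_mul_eq_of_augRel s k ε (c := pos (p 0)) AugRel.p_zero
    have c1 := D.commute_cenIncl_baseIncl s k ε (Multiplicative.ofAdd (D.cen s)) (P.gen s)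
    have c2 := D.commute_cenIncl_z s k ε (Multiplicative.ofAdd (D.cen s)) 0
    rw [← h4, ← h3, ← h2, ← h1, gen_neg, gen_old_i, Fin.val_zero, pow_zero, mul_one, gam_zero,
      ofAdd_add, map_mul]
    generalize D.cenIncl s k ε (Multiplicative.ofAdd (D.cen s)) = c at *
    generalize D.baseIncl s k ε (P.gen s) = σ at *
    generalize (D.augmentation s k ε).gen (pos (z 0)) = y at *
    rw [← mul_assoc, ← mul_assoc, ← mul_assoc, ← mul_assoc, inv_mul_cancel, one_mul,
      mul_assoc σ c, c2.eq, ← mul_assoc, mul_assoc (σ * y), c1.eq]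
    group
  | succ l ih =>
    have h1 := D.gen_mul_eq_of_augRel s k ε (c := pos (q l)) (AugRel.q_def l)
    have h2 := D.gen_mul_eq_of_augRel s k ε (c := pos (p l.succ)) (AugRel.p_succ l)
    have c2 := D.commute_cenIncl_z s k ε (Multiplicative.ofAdd (D.gam s k ε l)) 1
    rw [← h2, ← h1, ih, D.gen_old_of_μ s k ε (D.μ_bPow (k l) (ε l)), Fin.val_succ, gam_succ,
      ofAdd_add, map_mul, pow_succ, Fin.val_castSucc,
      mul_assoc _ _ ((D.augmentation s k ε).gen (pos (z 1))), c2.eq]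
    simp only [mul_assoc]

theorem gen_w (l : Fin (r + 1)) : (D.augmentation s k ε).gen (pos (w l)) =
    (D.augmentation s k ε).gen (pos (z 3)) * (D.augmentation s k ε).gen (pos (p (Fin.last r))) *
      ((D.augmentation s k ε).gen (pos (z 1)))⁻¹ ^ l.val := by
  induction l using Fin.induction with
  | zero =>
    have h1 := D.gen_mul_eq_of_augRel s k ε (c := pos (w 0)) AugRel.w_zero
    rw [← h1, Fin.val_zero, pow_zero, mul_one]
  | succ l ih =>
    have h1 := D.gen_mul_eq_of_augRel s k ε (c := pos (w l.succ)) (AugRel.w_succ l)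
    rw [← h1, ih, gen_neg, Fin.val_succ, pow_succ, Fin.val_castSucc, mul_assoc]

variable {k ε}

/-- In the augmentation, `t = s z₁ s`. -/
theorem gen_t (hexp : D.IsExpression s k ε) : (D.augmentation s k ε).gen (pos t) =
    D.baseIncl s k ε (P.gen s) * (D.augmentation s k ε).gen (pos (z 0)) *
      D.baseIncl s k ε (P.gen s) := by
  have h1 := D.gen_mul_eq_of_augRel s k ε (c := pos t) AugRel.t_def
  rw [← h1, gen_neg, gen_w, gen_p, Fin.val_last, gam_last D s hexp, ofAdd_zero, map_one]
  group

/-- If the generators of the augmentation have invertible differences, then `s` acts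
nontrivially. -/
theorem rep_baseIncl_ne_one (hexp : D.IsExpression s k ε) {F : Type} [Field F] {n : ℕ}
    (hn : 1 ≤ n) (ρ : (D.augmentation s k ε).Grp →* Matrix.GeneralLinearGroup (Fin n) F)
    (h : ∀ x y : AugGen T D.N r, x ≠ y →
      IsUnit ((ρ ((D.augmentation s k ε).gen x) : Matrix (Fin n) (Fin n) F) -
        (ρ ((D.augmentation s k ε).gen y) : Matrix (Fin n) (Fin n) F))) :
    ρ (D.baseIncl s k ε (P.gen s)) ≠ 1 := by
  intro h1
  have h2 := h (pos t) (pos (z 0)) (by simp)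
  have h3 := congrArg ρ (D.gen_t s hexp)
  rw [map_mul, map_mul, h1, one_mul, mul_one] at h3
  have : NeZero n := ⟨by omega⟩
  rw [h3, sub_self, isUnit_zero_iff] at h2
  exact zero_ne_one h2

/-- In a generic representation, distinct generators have invertible difference. -/
theorem isUnit_of_isGenericRep (hexp : D.IsExpression s k ε) {L : Type} [Field L] {n : ℕ}
    {ρ : AugWord P.Grp P.rel × Multiplicative (Fin D.N → ℤ) →*
      Matrix.GeneralLinearGroup (Fin n) L} (hρ : IsGenericRep (P.gen s) ρ)
    {x y : AugGen T D.N r} (h : x ≠ y) :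
    IsUnit ((ρ.comp (D.augHom s hexp) ((D.augmentation s k ε).gen x)).val -
      (ρ.comp (D.augHom s hexp) ((D.augmentation s k ε).gen y)).val) := by
  simp only [MonoidHom.comp_apply, augHom_gen]
  have h1 : UnitSubOne _ := unitSubOne_augVal (k := k) (ε := ε) hρ h
  have h2 : (ρ (D.augVal s k ε x)).val - (ρ (D.augVal s k ε y)).val =
      ((ρ (D.augVal s k ε x * (D.augVal s k ε y)⁻¹)).val - 1) * (ρ (D.augVal s k ε y)).val := by
    rw [sub_mul, ← Units.val_mul, ← map_mul, inv_mul_cancel_right, one_mul]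
  rw [h2]
  exact IsUnit.mul h1 (Units.isUnit _)

/-- In a generic representation, products of three generators are the identity or have no
eigenvalue `1`. -/
theorem isUnit_or_eq_zero_of_isGenericRep (hexp : D.IsExpression s k ε) {L : Type} [Field L]
    {n : ℕ} {ρ : AugWord P.Grp P.rel × Multiplicative (Fin D.N → ℤ) →*
      Matrix.GeneralLinearGroup (Fin n) L} (hρ : IsGenericRep (P.gen s) ρ)
    (x y z : AugGen T D.N r) :
    IsUnit (((ρ.comp (D.augHom s hexp) ((D.augmentation s k ε).gen z))⁻¹ :
        Matrix.GeneralLinearGroup (Fin n) L).val -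
      (ρ.comp (D.augHom s hexp)
        ((D.augmentation s k ε).gen y * (D.augmentation s k ε).gen x)).val) ∨
    ((ρ.comp (D.augHom s hexp) ((D.augmentation s k ε).gen z))⁻¹ :
        Matrix.GeneralLinearGroup (Fin n) L).val -
      (ρ.comp (D.augHom s hexp)
        ((D.augmentation s k ε).gen y * (D.augmentation s k ε).gen x)).val = 0 := by
  simp only [MonoidHom.comp_apply, map_mul, augHom_gen]
  rw [← map_mul]
  have h1 := unitOrOne_augVal (k := k) (ε := ε) hρ z y x
  have h2 : ((ρ (D.augVal s k ε z))⁻¹ : Matrix.GeneralLinearGroup (Fin n) L).val -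
      (ρ (D.augVal s k ε y * D.augVal s k ε x)).val =
      -(((ρ (D.augVal s k ε z))⁻¹ : Matrix.GeneralLinearGroup (Fin n) L).val *
        ((ρ (D.augVal s k ε z * D.augVal s k ε y * D.augVal s k ε x)).val - 1)) := by
    have h3 : ρ (D.augVal s k ε y * D.augVal s k ε x) = (ρ (D.augVal s k ε z))⁻¹ *
        ρ (D.augVal s k ε z * D.augVal s k ε y * D.augVal s k ε x) := by
      rw [← map_inv, ← map_mul, mul_assoc (D.augVal s k ε z), inv_mul_cancel_left]
    rw [mul_sub, ← Units.val_mul, ← h3, mul_one, neg_sub]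
  rw [h2]
  refine h1.imp (fun h => ?_) fun h => ?_
  · exact (IsUnit.mul (Units.isUnit _) h).neg
  · rw [h]
    simp

end Scrambling

/-! ### The equivalence. -/

theorem mainTheorem8 {S : Type u} {T : Type v} (P : SymTriPres S) (Q : SymTriPres T)
    (D : Scrambling P Q) (s : S)
    {r : ℕ} (k : Fin r → Fin D.N) (ε : Fin r → ℤˣ) (hkε : D.IsMinExpression s k ε) :
    (∃ (F : Type) (_ : Field F) (_ : Algebra ℂ F) (n : ℕ)
        (ρ : P.Grp →* Matrix.GeneralLinearGroup (Fin n) F),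
        1 ≤ n ∧ ρ (P.gen s) ≠ ρ 1) ↔
    (∃ (F : Type) (_ : Field F) (_ : Algebra ℂ F) (n : ℕ)
        (ρ : (D.augmentation s k ε).Grp →* Matrix.GeneralLinearGroup (Fin n) F),
        1 ≤ n ∧
        (∀ x y : AugGen T D.N r, x ≠ y →
          IsUnit ((ρ ((D.augmentation s k ε).gen x) : Matrix (Fin n) (Fin n) F) -
            (ρ ((D.augmentation s k ε).gen y) : Matrix (Fin n) (Fin n) F))) ∧
        (∀ x y z : AugGen T D.N r,
          IsUnit (((ρ ((D.augmentation s k ε).gen z))⁻¹ :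
              Matrix.GeneralLinearGroup (Fin n) F).val -
            (ρ ((D.augmentation s k ε).gen y * (D.augmentation s k ε).gen x)).val) ∨
          ((ρ ((D.augmentation s k ε).gen z))⁻¹ :
              Matrix.GeneralLinearGroup (Fin n) F).val -
            (ρ ((D.augmentation s k ε).gen y * (D.augmentation s k ε).gen x)).val = 0)) := by
  have hexp := hkε.1
  constructor
  · rintro ⟨F, _, _, n, ρ, -, hρ⟩
    rw [map_one] at hρ
    have := P.finite_gen
    obtain ⟨H, _, _, q, hq⟩ :=
      exists_finite_quotient_of_linear P.gen P.closure_range_gen ρ hρ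
    have : Finite P.rel := Set.toFinite _
    obtain ⟨n, hn, L, _, _, τ, hτ⟩ := exists_isGenericRep (T := P.rel) (N := D.N) q hq
    exact ⟨L, inferInstance, inferInstance, n, τ.comp (D.augHom s hexp), hn,
      fun x y h => D.isUnit_of_isGenericRep s hexp hτ h,
      D.isUnit_or_eq_zero_of_isGenericRep s hexp hτ⟩
  · rintro ⟨F, _, _, n, ρ, hn, h, -⟩
    refine ⟨F, inferInstance, inferInstance, n, ρ.comp (D.baseIncl s k ε), hn, ?_⟩
    rw [map_one]
    exact D.rep_baseIncl_ne_one s hexp hn ρ h
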